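/- Let $\mathbb{S}^2\subset\mathbb{R}^3$ be the unit sphere with its surface measure $\lambda$ (of total mass $4\pi$), let $\gamma\in\mathbb{R}$, let $\breve\Omega(t)\in\mathbb{R}^3$, and let $$\mathcal{G}[\phi](x)=-(\breve\Omega(t)\times x+\gamma^2x)^{\mathsf T}\nabla\phi(x)+\tfrac12\operatorname{tr}\big[Q(x)\nabla^2\phi(x)\big],\qquad Q(x)=\gamma^2(\|x\|^2\mathrm{I}-xx^{\mathsf T}),$$ be the generator of the diffusion $\mathrm{d}X=-\breve\Omega(t)\times X\,\mathrm{d}t-\gamma^2X\,\mathrm{d}t+\gamma X\times\mathrm{d}W$, which stays on $\mathbb{S}^2$. Let $\mathcal{G}^a$ be its adjoint in $L_2(\mathbb{S}^2,\lambda)$, that is, $\int\mathcal{G}[\phi]\,p\,\mathrm{d}\lambda=\int\phi\,\mathcal{G}^a[p]\,\mathrm{d}\lambda$ for all $C^2$ functions $\phi$. For $\theta\in\mathbb{R}^3$ let $p_\theta(x)=\exp(\theta^{\mathsf T}x-\kappa(\|\theta\|))$ be the von Mises--Fisher density, $\kappa(r)=-\log r+\log(4\pi)+\log\sinh r$ (with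 $\kappa(0)=\log(4\pi)$), and let $\Pi_\theta$ be the orthogonal projection of $L_2(\mathbb{S}^2,\lambda)$ onto $\operatorname{span}\{\partial_{\theta_1}\sqrt{p_\theta},\partial_{\theta_2}\sqrt{p_\theta},\partial_{\theta_3}\sqrt{p_\theta}\}$. Given a filter parameter $\theta_F(t)\in\mathbb{R}^3$, the projection smoother is the curve $\theta_S$ in $\mathbb{R}^3$ defined by the following equation in $L_2(\mathbb{S}^2,\lambda)$: $$\partial_t\sqrt{p_{\theta_S}}=\Pi_{\theta_S}\,\widehat{\mathcal{B}}^{1/2}[\sqrt{p_{\theta_S}}],\qquad \widehat{\mathcal{B}}^{1/2}[\phi]=\frac{\phi}{2\phi^2}\Big(\frac{\phi^2}{p_{\theta_F}}\mathcal{G}^a[p_{\theta_F}]-p_{\theta_F}\,\mathcal{G}\Big[\frac{\phi^2}{p_{\theta_F}}\Big]\Big).$$ Then, at every time $t$ at which $\theta_S(t)\neq0$, the curve $\theta_S$ satisfies this equation if and only if it is differentiable at $t$ with $$\dot\theta_S=-\breve\Omega(t)\times\theta_S-\frac{\gamma^2\kappa'(\|\theta_S\|)}{\|\theta_S\|\,\kappa''(\|\theta_S\|)}\,\theta_S+G(\theta_S)(\theta_S-\theta_F),$$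 where, with $P(\theta)=\theta\theta^{\mathsf T}/\|\theta\|^2$ and $P_\perp(\theta)=\mathrm{I}-P(\theta)$, $$G(\theta)=\frac{\gamma^2\|\theta\|}{\kappa'(\|\theta\|)}P_\perp(\theta)+\frac{\gamma^2\big[1-(\kappa'(\|\theta\|))^2\big]}{\kappa''(\|\theta\|)}P(\theta)-\gamma^2\mathrm{I}.$$ (Time derivatives may be taken within any given set of times containing $t$, for instance an interval between two measurement times.) -/

import Mathlib

open MeasureTheory

noncomputable section

namespace VMF

/-- Euclidean space `ℝ³`. -/
abbrev E3 : Type := EuclideanSpace ℝ (Fin 3)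

/-- The unit sphere `𝕊²` in `ℝ³`. -/
abbrev S2 : Type := Metric.sphere (0 : E3) 1

/-- The uniform (surface) measure on `𝕊²`, of total mass `4π`. -/
def surfaceMeasure : Measure S2 := (volume : Measure E3).toSphere

instance : IsFiniteMeasure surfaceMeasure := by
  unfold surfaceMeasure
  infer_instance

/-- The real Hilbert space `L²(𝕊², λ)`. -/
abbrev L2S2 : Type := Lp ℝ 2 surfaceMeasure

/-- The cross product on Euclidean `ℝ³`. -/
def cross (u v : E3) : E3 := WithLp.toLp 2 (crossProduct u.ofLp v.ofLp)

/-! ### The generator of an Itô diffusion and its adjoint on the sphere -/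

/-- The partial derivative `∂ᵢ φ`. -/
def partialDeriv {d : ℕ} (i : Fin d) (φ : EuclideanSpace ℝ (Fin d) → ℝ)
    (x : EuclideanSpace ℝ (Fin d)) : ℝ :=
  fderiv ℝ φ x (EuclideanSpace.single i 1)

/-- The generator `𝒢[φ] = ∑ᵢ aᵢ ∂ᵢφ + ½ ∑ᵢⱼ Qᵢⱼ ∂ᵢ∂ⱼφ`, `Q = σ σᵀ`, of the Itô diffusion
`dX = a(X) dt + σ(X) dW` (coefficients frozen at the current time). -/
def generator {d q : ℕ} (a : EuclideanSpace ℝ (Fin d) → EuclideanSpace ℝ (Fin d))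
    (σ : EuclideanSpace ℝ (Fin d) → Matrix (Fin d) (Fin q) ℝ)
    (φ : EuclideanSpace ℝ (Fin d) → ℝ) (x : EuclideanSpace ℝ (Fin d)) : ℝ :=
  ∑ i, a x i * partialDeriv i φ x
    + (1 / 2) * ∑ i, ∑ j, (σ x * (σ x).transpose) i j * partialDeriv i (partialDeriv j φ) x

/-- The drift `a(t, x) = -Ω(t) × x - γ² x`. -/
def drift (γ : ℝ) (Ω : ℝ → E3) (t : ℝ) (x : E3) : E3 :=
  -cross (Ω t) x - γ ^ 2 • x

/-- The diffusion coefficient: the matrix `σ(x)` with `σ(x) w = γ x × w`. -/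
def diffusion (γ : ℝ) (x : E3) : Matrix (Fin 3) (Fin 3) ℝ :=
  γ • LinearMap.toMatrix' (crossProduct x.ofLp)

/-- The generator at time `t` of `dX = -Ω(t) × X dt - γ² X dt + γ X × dW`. This diffusion stays on
the sphere, so at points of `𝕊²` the value depends only on the restriction of `φ` to `𝕊²`. -/
def sphereGenerator (γ : ℝ) (Ω : ℝ → E3) (t : ℝ) (φ : E3 → ℝ) (x : E3) : ℝ :=
  generator (drift γ Ω t) (diffusion γ) φ x

/-- `u = 𝒢ᵃ[p]`, where `𝒢ᵃ` is the adjoint of `𝒢` in `L²(𝕊², λ)`: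
`∫ 𝒢[φ] p dλ = ∫ φ u dλ` for every `C²` function `φ`. -/
def IsAdjointValue (γ : ℝ) (Ω : ℝ → E3) (t : ℝ) (p : E3 → ℝ) (u : L2S2) : Prop :=
  ∀ φ : E3 → ℝ, ContDiff ℝ 2 φ →
    ∫ x : S2, sphereGenerator γ Ω t φ x * p x ∂surfaceMeasure
      = ∫ x : S2, φ x * u x ∂surfaceMeasure

/-! ### The von Mises–Fisher family -/

/-- The log-normalizer `κ(r) = -log r + log (4π) + log sinh r`. -/
def kappa (r : ℝ) : ℝ := -Real.log r + Real.log (4 * Real.pi) + Real.log (Real.sinh r)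

/-- The von Mises–Fisher density `p_θ(x) = exp(θᵀ x - κ(‖θ‖))`. -/
def density (θ x : E3) : ℝ := Real.exp (inner ℝ θ x - kappa ‖θ‖)

/-- The square root density `√p_θ`. -/
def sqrtDensity (θ x : E3) : ℝ := Real.sqrt (density θ x)

theorem continuous_sqrtDensity (θ : E3) : Continuous fun x : S2 => sqrtDensity θ x := by
  unfold sqrtDensity density
  fun_prop

/-- `√p_θ` as an element of `L²(𝕊², λ)`. -/
def sqrtDensityL2 (θ : E3) : L2S2 :=
  ContinuousMap.toLp 2 surfaceMeasure ℝ ⟨fun x : S2 => sqrtDensity θ x, continuous_sqrtDensity θ⟩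

/-- The tangent space `span {∂₁ √p_θ, ∂₂ √p_θ, ∂₃ √p_θ} ⊆ L²(𝕊², λ)` of the family of square root
densities at `√p_θ`, with `∂ᵢ` the partial derivative in `θᵢ` of `θ ↦ √p_θ ∈ L²(𝕊², λ)`. -/
def tangentSpace (θ : E3) : Submodule ℝ L2S2 :=
  Submodule.span ℝ
    (Set.range fun i : Fin 3 => lineDeriv ℝ sqrtDensityL2 θ (EuclideanSpace.single i 1))

instance (θ : E3) : FiniteDimensional ℝ (tangentSpace θ) :=
  FiniteDimensional.span_of_finite ℝ (Set.finite_range _)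

/-- The orthogonal projection `Π_θ` of `L²(𝕊², λ)` onto the tangent space at `√p_θ`. -/
def tangentProjection (θ : E3) (v : L2S2) : L2S2 := (tangentSpace θ).starProjection v

/-! ### The projection smoother -/

/-- The operator
`φ ↦ φ / (2 φ²) * (φ² / p_{θ_F} * 𝒢ᵃ[p_{θ_F}] - p_{θ_F} * 𝒢[φ² / p_{θ_F}])`
at time `t`, where `η` is the value of `θ_F` at time `t` and `u` stands for `𝒢ᵃ[p_{θ_F}]`. -/
def smoothingOperator (γ : ℝ) (Ω : ℝ → E3) (t : ℝ) (η : E3) (u : L2S2) (φ : E3 → ℝ)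
    (x : S2) : ℝ :=
  φ x / (2 * φ x ^ 2) *
    (φ x ^ 2 / density η x * u x
      - density η x * sphereGenerator γ Ω t (fun y => φ y ^ 2 / density η y) x)

/-- The curve `θS` solves the projection smoother equation
`∂ₜ √p_{θ_S} = Π_{θ_S} (B[√p_{θ_S}])` in `L²(𝕊², λ)` at time `t`, within the set of times `I`,
where `B` is the smoothing operator built from the filter parameter `θF`. -/
def SolvesProjectionSmoother (γ : ℝ) (Ω θF θS : ℝ → E3) (I : Set ℝ) (t : ℝ) : Prop :=
  ∃ u : L2S2, IsAdjointValue γ Ω t (density (θF t)) u ∧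
    ∃ hB : MemLp (smoothingOperator γ Ω t (θF t) u (sqrtDensity (θS t))) 2 surfaceMeasure,
      HasDerivWithinAt (fun s => sqrtDensityL2 (θS s))
        (tangentProjection (θS t) (hB.toLp _)) I t

/-! ### The matrices in the smoother formula -/

/-- `P(θ) = θ θᵀ / ‖θ‖²`. -/
def projPar (θ : E3) : Matrix (Fin 3) (Fin 3) ℝ :=
  (1 / ‖θ‖ ^ 2) • Matrix.vecMulVec θ.ofLp θ.ofLp

/-- `P_⊥(θ) = I - P(θ)`. -/
def projPerp (θ : E3) : Matrix (Fin 3) (Fin 3) ℝ := 1 - projPar θ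

/-- `G(θ) = γ² ‖θ‖ / κ'(‖θ‖) P_⊥(θ) + γ² (1 - κ'(‖θ‖)²) / κ''(‖θ‖) P(θ) - γ² I`. -/
def gainMatrix (γ : ℝ) (θ : E3) : Matrix (Fin 3) (Fin 3) ℝ :=
  (γ ^ 2 * ‖θ‖ / deriv kappa ‖θ‖) • projPerp θ
    + (γ ^ 2 * (1 - deriv kappa ‖θ‖ ^ 2) / deriv (deriv kappa) ‖θ‖) • projPar θ
    - γ ^ 2 • (1 : Matrix (Fin 3) (Fin 3) ℝ)

end VMF

end

noncomputable section

namespace VMF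

open scoped Pointwise

/-! Let D be the derivative of θ ↦ √p_θ at θ = θ_S(t). Since θ ≠ 0, the tangent space is the range
of D. An element of this range is the projection of the smoothing operator B exactly when it has the
same inner products with all Dv. So the claim is the normal equation D*D c = D*B for the stated
velocity c, plus the fact that the L² curve determines θ_S differentiably.

To compute D*B, the generator is written as γ²/2 times a sum of squares of rotation fields, minus
the field of Ω (`sphereGenerator_eq`). Rotations preserve the surface measure, so each field has
zero mean and is skew. Put h = p_θ/p_{θ_F} and g = bᵀx - c. The adjoint relation tested on hg turns
the pairing into half the integral of (𝒢[hg] - g𝒢[h]) p_{θ_F}. By the second order product rule this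
is half the integral of p_θ (𝒢[g] + Γ(log h, g)), where Γ is the carré du champ. As log h is affine,
only first and second moments of p_θ remain.

These moments are derivatives of the integral of exp(θᵀx), which solves an ODE because Laplacians
integrate to zero. The Gram operator D*D has eigenvalue κ'/(4‖θ‖) orthogonally to θ and κ''/4 along
θ. Both are positive, and `gramL_smootherField` verifies the normal equation.

Conversely, θ_S is not assumed continuous. Its continuity at t is recovered from ratios of moments
of √p_θ. The inverse function theorem for D* √p_θ, whose derivative D*D is invertible, then gives
differentiability. -/

/-! ### Cross products in coordinates -/

theorem cross_apply_zero (u v : E3) : cross u v 0 = u 1 * v 2 - u 2 * v 1 := by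
  simp [cross, crossProduct]

theorem cross_apply_one (u v : E3) : cross u v 1 = u 2 * v 0 - u 0 * v 2 := by
  simp [cross, crossProduct]

theorem cross_apply_two (u v : E3) : cross u v 2 = u 0 * v 1 - u 1 * v 0 := by
  simp [cross, crossProduct]

theorem inner_eq_three (u v : E3) : inner ℝ u v = u 0 * v 0 + u 1 * v 1 + u 2 * v 2 := by
  simp [PiLp.inner_apply, Fin.sum_univ_three, mul_comm]

theorem norm_sq_eq_three (u : E3) : ‖u‖ ^ 2 = u 0 ^ 2 + u 1 ^ 2 + u 2 ^ 2 := by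
  rw [← real_inner_self_eq_norm_sq, inner_eq_three]; ring

theorem sphere_sq_sum (x : S2) :
    (x : E3) 0 ^ 2 + (x : E3) 1 ^ 2 + (x : E3) 2 ^ 2 = 1 := by
  rw [← norm_sq_eq_three, norm_eq_of_mem_sphere]; norm_num

/-- The cross product `v ↦ a × v` as a continuous linear map. -/
def crossL (a : E3) : E3 →L[ℝ] E3 :=
  LinearMap.toContinuousLinearMap
    { toFun := cross a
      map_add' := fun x y => by simp [cross]
      map_smul' := fun c x => by simp [cross] }

@[simp] theorem crossL_apply (a x : E3) : crossL a x = cross a x := rfl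

theorem inner_cross_left (a x y : E3) : inner ℝ (cross a x) y = - inner ℝ x (cross a y) := by
  simp only [inner_eq_three, cross_apply_zero, cross_apply_one, cross_apply_two]; ring

theorem crossL_mem_skewAdjoint (a : E3) : crossL a ∈ skewAdjoint (E3 →L[ℝ] E3) := by
  rw [skewAdjoint.mem_iff, ContinuousLinearMap.star_eq_adjoint, eq_comm,
    ContinuousLinearMap.eq_adjoint_iff]
  intro x y
  simp [inner_cross_left]

/-! ### Rotations and invariance of the surface measure -/

/-- A linear isometry equivalence acting on the sphere. -/
def sphereMap (e : E3 ≃ₗᵢ[ℝ] E3) (x : S2) : S2 := ⟨e x, by simp⟩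

theorem continuous_sphereMap (e : E3 ≃ₗᵢ[ℝ] E3) : Continuous (sphereMap e) :=
  (e.continuous.comp continuous_subtype_val).subtype_mk _

/-- The surface measure of a set is defined by the volume of the cone over it, and a linear isometry
carries cones to cones and preserves volume. -/
theorem measurePreserving_sphereMap (e : E3 ≃ₗᵢ[ℝ] E3) :
    MeasurePreserving (sphereMap e) surfaceMeasure surfaceMeasure := by
  have hm := (continuous_sphereMap e).measurable
  refine ⟨hm, Measure.ext fun s hs => ?_⟩
  rw [Measure.map_apply hm hs, surfaceMeasure, Measure.toSphere_apply' _ (hm hs),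
    Measure.toSphere_apply' _ hs]
  congr 1
  rw [← e.measurePreserving.measure_preimage_emb e.toHomeomorph.measurableEmbedding
    (Set.Ioo (0 : ℝ) 1 • (Subtype.val '' s))]
  congr 1
  ext y
  simp only [Set.mem_smul, Set.mem_image, Set.mem_preimage]
  constructor
  · rintro ⟨r, hr, _, ⟨x, hx, rfl⟩, rfl⟩
    exact ⟨r, hr, _, ⟨_, hx, rfl⟩, by simp [sphereMap]⟩
  · rintro ⟨r, hr, _, ⟨x, hx, rfl⟩, h⟩
    refine ⟨r, hr, _, ⟨sphereMap e.symm x, ?_, rfl⟩, ?_⟩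
    · convert hx; simp [sphereMap]
    · apply e.injective; simp [sphereMap, h]

/-- The one-parameter group generated by `v ↦ a × v` consists of isometries. -/
theorem exists_rotation (a : E3) (s : ℝ) :
    ∃ e : E3 ≃ₗᵢ[ℝ] E3, ∀ x, e x = NormedSpace.exp (s • crossL a) x := by
  have h : NormedSpace.exp (s • crossL a) ∈ unitary (E3 →L[ℝ] E3) :=
    let _ : NormedAlgebra ℚ (E3 →L[ℝ] E3) := NormedAlgebra.restrictScalars ℚ ℝ _
    NormedSpace.exp_mem_unitary_of_mem_skewAdjoint
      (skewAdjoint.smul_mem s (crossL_mem_skewAdjoint a))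
  exact ⟨Unitary.linearIsometryEquiv ⟨_, h⟩, fun x => rfl⟩

/-- The derivative of `φ` along the rotation field `x ↦ a × x`. -/
def rot (a : E3) (φ : E3 → ℝ) (x : E3) : ℝ := fderiv ℝ φ x (cross a x)

theorem contDiff_crossL (a : E3) {n : WithTop ℕ∞} : ContDiff ℝ n (cross a) :=
  (crossL a).contDiff

theorem contDiff_rot {m n : WithTop ℕ∞} {φ : E3 → ℝ} (hφ : ContDiff ℝ n φ) (hmn : m + 1 ≤ n)
    (a : E3) : ContDiff ℝ m (rot a φ) :=
  (hφ.fderiv_right hmn).clm_apply (contDiff_crossL a)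

theorem integrable_of_continuous {f : S2 → ℝ} (hf : Continuous f) :
    Integrable f surfaceMeasure :=
  hf.integrable_of_hasCompactSupport (HasCompactSupport.of_compactSpace f)

/-- By invariance, the integral of φ composed with the rotation by exp(s a×) does not depend on s;
differentiate it under the integral at s = 0. -/
theorem integral_rot (a : E3) {φ : E3 → ℝ} (hφ : ContDiff ℝ 1 φ) :
    ∫ x : S2, rot a φ x ∂surfaceMeasure = 0 := by
  choose e he using exists_rotation a
  have hrot : Continuous (fun x : S2 => rot a φ x) :=
    (contDiff_rot (m := 0) hφ (by simp) a).continuous.comp continuous_subtype_val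
  obtain ⟨C, hC⟩ := (isCompact_univ (X := S2)).exists_bound_of_continuousOn hrot.continuousOn
  have hcont : ∀ s, Continuous fun x : S2 => φ (sphereMap (e s) x) := fun s =>
    hφ.continuous.comp (continuous_subtype_val.comp (continuous_sphereMap _))
  have hd := (hasDerivAt_integral_of_dominated_loc_of_deriv_le (μ := surfaceMeasure)
    (F := fun s (x : S2) => φ (sphereMap (e s) x))
    (F' := fun s (x : S2) => rot a φ (sphereMap (e s) x)) (bound := fun _ => C)
    (x₀ := 0) (s := Set.univ) Filter.univ_mem
    (Filter.Eventually.of_forall fun s => (hcont s).aestronglyMeasurable)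
    (integrable_of_continuous (hcont 0))
    (hrot.comp (continuous_sphereMap _)).aestronglyMeasurable
    (Filter.Eventually.of_forall fun x s _ => hC _ (Set.mem_univ _))
    (integrable_const _) ?_).2
  · have hconst : (fun s => ∫ x : S2, φ (sphereMap (e s) x) ∂surfaceMeasure)
        = fun _ => ∫ x : S2, φ x ∂surfaceMeasure := by
      funext s
      have := integral_map (μ := surfaceMeasure) (f := fun x : S2 => φ x)
        (continuous_sphereMap (e s)).aemeasurable
        (hφ.continuous.comp continuous_subtype_val).aestronglyMeasurable
      rw [← this, (measurePreserving_sphereMap (e s)).map_eq]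
    rw [hconst] at hd
    have h0 := hd.unique (hasDerivAt_const _ _)
    rw [← h0]
    refine integral_congr_ae (Filter.Eventually.of_forall fun x => ?_)
    have h1 : NormedSpace.exp ((0 : ℝ) • crossL a) = 1 := by
      have h2 : (0 : ℝ) • crossL a = 0 := by ext; simp
      rw [h2]
      let _ : NormedAlgebra ℚ (E3 →L[ℝ] E3) := NormedAlgebra.restrictScalars ℚ ℝ _
      exact NormedSpace.exp_zero
    have : sphereMap (e 0) x = x := Subtype.ext (by simp [sphereMap, he, h1])
    simp [this]
  · refine Filter.Eventually.of_forall fun x s _ => ?_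
    have h1 := (hasDerivAt_exp_smul_const' (𝕂 := ℝ) (crossL a) s).clm_apply
      (hasDerivAt_const s (x : E3))
    have h2 := ((hφ.differentiable (by simp)) _).hasFDerivAt.comp_hasDerivAt s h1
    simp only [map_zero, add_zero] at h2
    have key : ∀ s, ((sphereMap (e s) x : S2) : E3)
        = NormedSpace.exp (s • crossL a) (x : E3) := fun s => he s x
    simp only [rot, key]
    simpa [Function.comp_def] using h2

/-! ### The generator as a sum of squares of rotation fields -/

/-- The standard basis vectors of `ℝ³`. -/
abbrev stdVec (k : Fin 3) : E3 := EuclideanSpace.single k 1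

theorem eq_sum_stdVec (v : E3) : v = v 0 • stdVec 0 + v 1 • stdVec 1 + v 2 • stdVec 2 := by
  ext i
  fin_cases i <;> simp

theorem clm_apply_eq_sum {F : Type*} [NormedAddCommGroup F] [NormedSpace ℝ F] (L : E3 →L[ℝ] F)
    (v : E3) :
    L v = v 0 • L (stdVec 0) + v 1 • L (stdVec 1) + v 2 • L (stdVec 2) := by
  conv_lhs => rw [eq_sum_stdVec v]
  simp only [map_add, map_smul]

theorem fderiv_rot {φ : E3 → ℝ} (hφ : ContDiff ℝ 2 φ) (b x v : E3) :
    fderiv ℝ (rot b φ) x v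
      = fderiv ℝ (fderiv ℝ φ) x v (cross b x) + fderiv ℝ φ x (cross b v) := by
  have h1 : HasFDerivAt (fderiv ℝ φ) (fderiv ℝ (fderiv ℝ φ) x) x :=
    ((hφ.fderiv_right (m := 1) (by norm_num)).differentiable (by simp) x).hasFDerivAt
  have h2 : HasFDerivAt (cross b) (crossL b) x := (crossL b).hasFDerivAt
  have h3 : HasFDerivAt (rot b φ) _ x := h1.clm_apply h2
  rw [h3.fderiv]
  simp [add_comm]

theorem partialDeriv_partialDeriv {φ : E3 → ℝ} (hφ : ContDiff ℝ 2 φ) (i j : Fin 3) (x : E3) :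
    partialDeriv i (partialDeriv j φ) x
      = fderiv ℝ (fderiv ℝ φ) x (stdVec i) (stdVec j) := by
  have h1 : HasFDerivAt (fderiv ℝ φ) (fderiv ℝ (fderiv ℝ φ) x) x :=
    ((hφ.fderiv_right (m := 1) (by norm_num)).differentiable (by simp) x).hasFDerivAt
  have h3 : HasFDerivAt (partialDeriv j φ) _ x :=
    h1.clm_apply (hasFDerivAt_const (stdVec j) x)
  unfold partialDeriv at h3 ⊢
  rw [h3.fderiv]
  simp

theorem diffusion_mul_transpose (γ : ℝ) (x : E3) (i j : Fin 3) :
    (diffusion γ x * (diffusion γ x).transpose) i j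
      = γ ^ 2 * ((if i = j then x 0 ^ 2 + x 1 ^ 2 + x 2 ^ 2 else 0) - x i * x j) := by
  fin_cases i <;> fin_cases j <;>
    simp [diffusion, Matrix.mul_apply, Fin.sum_univ_three, LinearMap.toMatrix'_apply,
      crossProduct] <;> ring

/-- This is the Stratonovich form. The vectors e_k × x have Gram sum ‖x‖² I - xxᵀ, which gives Q,
and the sum of e_k × (e_k × x) is -2x, so the squares also produce the drift -γ²x. -/
theorem sphereGenerator_eq (γ : ℝ) (Ω : ℝ → E3) (t : ℝ) {φ : E3 → ℝ} (hφ : ContDiff ℝ 2 φ)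
    (x : E3) :
    sphereGenerator γ Ω t φ x
      = γ ^ 2 / 2 * ∑ k, rot (stdVec k) (rot (stdVec k) φ) x - rot (Ω t) φ x := by
  simp only [sphereGenerator, generator, diffusion_mul_transpose, partialDeriv_partialDeriv hφ,
    Fin.sum_univ_three]
  have h1 : ∀ k, rot (stdVec k) (rot (stdVec k) φ) x = _ := fun k => fderiv_rot hφ _ _ _
  simp only [h1]
  simp only [rot, clm_apply_eq_sum (fderiv ℝ φ x) (cross _ _),
    clm_apply_eq_sum (fderiv ℝ (fderiv ℝ φ) x) (cross _ _), add_apply,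
    smul_apply, clm_apply_eq_sum (fderiv ℝ (fderiv ℝ φ) x _) (cross _ _)]
  simp only [partialDeriv, drift, cross_apply_zero, cross_apply_one, cross_apply_two, smul_eq_mul,
    PiLp.sub_apply, PiLp.neg_apply, PiLp.smul_apply]
  simp
  ring

theorem rot_mul (a : E3) {f g : E3 → ℝ} (hf : Differentiable ℝ f) (hg : Differentiable ℝ g)
    (x : E3) : rot a (fun y => f y * g y) x = f x * rot a g x + rot a f x * g x := by
  unfold rot
  have h : HasFDerivAt (fun y => f y * g y) _ x := (hf x).hasFDerivAt.mul (hg x).hasFDerivAt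
  rw [h.fderiv]
  simp [mul_comm]

theorem rot_add (a : E3) {f g : E3 → ℝ} (hf : Differentiable ℝ f) (hg : Differentiable ℝ g)
    (x : E3) : rot a (fun y => f y + g y) x = rot a f x + rot a g x := by
  unfold rot
  have h : HasFDerivAt (fun y => f y + g y) _ x := (hf x).hasFDerivAt.add (hg x).hasFDerivAt
  rw [h.fderiv]
  simp

theorem rot_inner_sub (a b : E3) (c : ℝ) (x : E3) :
    rot a (fun y => inner ℝ b y - c) x = inner ℝ b (cross a x) := by
  have h : HasFDerivAt (fun y => inner ℝ b y - c) (innerSL ℝ b) x :=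
    ((innerSL ℝ b).hasFDerivAt).sub_const c
  rw [rot, h.fderiv]; simp

theorem rot_inner_cross (a b : E3) (x : E3) :
    rot a (fun y => inner ℝ b (cross a y)) x = inner ℝ b (cross a (cross a x)) := by
  have h : HasFDerivAt (fun y => inner ℝ b (cross a y)) ((innerSL ℝ b).comp (crossL a)) x :=
    ((innerSL ℝ b).comp (crossL a)).hasFDerivAt
  rw [rot, h.fderiv]; simp

theorem contDiff_inner_sub (b : E3) (c : ℝ) {n : WithTop ℕ∞} :
    ContDiff ℝ n fun y : E3 => inner ℝ b y - c :=
  (innerSL ℝ b).contDiff.sub contDiff_const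

theorem contDiff_exp_inner (b : E3) (c : ℝ) {n : WithTop ℕ∞} :
    ContDiff ℝ n fun y : E3 => Real.exp (inner ℝ b y - c) :=
  Real.contDiff_exp.comp (contDiff_inner_sub b c)

theorem rot_exp_inner (a b : E3) (c : ℝ) (x : E3) :
    rot a (fun y => Real.exp (inner ℝ b y - c)) x
      = Real.exp (inner ℝ b x - c) * inner ℝ b (cross a x) := by
  have h : HasFDerivAt (fun y => inner ℝ b y - c) (innerSL ℝ b) x :=
    ((innerSL ℝ b).hasFDerivAt).sub_const c
  rw [rot, h.exp.fderiv]; simp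

/-- The generator is a second order derivation. -/
theorem sphereGenerator_mul (γ : ℝ) (Ω : ℝ → E3) (t : ℝ) {h g : E3 → ℝ} (hh : ContDiff ℝ 2 h)
    (hg : ContDiff ℝ 2 g) (x : E3) :
    sphereGenerator γ Ω t (fun y => h y * g y) x
      = h x * sphereGenerator γ Ω t g x + g x * sphereGenerator γ Ω t h x
        + γ ^ 2 * ∑ k, rot (stdVec k) h x * rot (stdVec k) g x := by
  have dh := hh.differentiable (by simp)
  have dg := hg.differentiable (by simp)
  have d1 : ∀ a, Differentiable ℝ (rot a h) := fun a =>
    (contDiff_rot (m := 1) hh (by norm_num) a).differentiable (by simp)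
  have d2 : ∀ a, Differentiable ℝ (rot a g) := fun a =>
    (contDiff_rot (m := 1) hg (by norm_num) a).differentiable (by simp)
  have key : ∀ k, rot (stdVec k) (rot (stdVec k) fun y => h y * g y) x
      = h x * rot (stdVec k) (rot (stdVec k) g) x + g x * rot (stdVec k) (rot (stdVec k) h) x
        + 2 * (rot (stdVec k) h x * rot (stdVec k) g x) := by
    intro k
    have : rot (stdVec k) (fun y => h y * g y)
        = fun y => h y * rot (stdVec k) g y + rot (stdVec k) h y * g y :=
      funext (rot_mul _ dh dg)
    rw [this, rot_add _ (f := fun y => h y * rot (stdVec k) g y)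
      (g := fun y => rot (stdVec k) h y * g y) (dh.mul (d2 _))
      ((d1 _).mul dg), rot_mul _ dh (d2 _), rot_mul _ (d1 _) dg]
    ring
  rw [sphereGenerator_eq _ _ _ (hh.mul hg), sphereGenerator_eq _ _ _ hh,
    sphereGenerator_eq _ _ _ hg, rot_mul _ dh dg]
  simp only [key, Fin.sum_univ_three]
  ring

theorem sphereGenerator_inner_sub (γ : ℝ) (Ω : ℝ → E3) (t : ℝ) (b : E3) (c : ℝ) (x : E3) :
    sphereGenerator γ Ω t (fun y => inner ℝ b y - c) x
      = -γ ^ 2 * inner ℝ b x - inner ℝ b (cross (Ω t) x) := by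
  rw [sphereGenerator_eq _ _ _ (contDiff_inner_sub b c)]
  have h1 : ∀ a, rot a (fun y => inner ℝ b y - c) = fun y => inner ℝ b (cross a y) :=
    fun a => funext (rot_inner_sub a b c)
  simp only [h1, rot_inner_cross]
  simp only [Fin.sum_univ_three, inner_eq_three, cross_apply_zero,
    cross_apply_one, cross_apply_two]
  simp
  ring

theorem sum_inner_cross_stdVec (a b x : E3) :
    ∑ k, inner ℝ a (cross (stdVec k) x) * inner ℝ b (cross (stdVec k) x)
      = ‖x‖ ^ 2 * inner ℝ a b - inner ℝ a x * inner ℝ b x := by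
  simp only [Fin.sum_univ_three, inner_eq_three, norm_sq_eq_three, cross_apply_zero,
    cross_apply_one, cross_apply_two]
  simp
  ring

/-! ### The adjoint and the pairing with the smoothing operator -/

/-- The formal adjoint of the generator. -/
def adjointGenerator (γ : ℝ) (Ω : ℝ → E3) (t : ℝ) (p : E3 → ℝ) (x : E3) : ℝ :=
  γ ^ 2 / 2 * ∑ k, rot (stdVec k) (rot (stdVec k) p) x + rot (Ω t) p x

theorem continuous_restrict {f : E3 → ℝ} (hf : Continuous f) : Continuous fun x : S2 => f x :=
  hf.comp continuous_subtype_val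

theorem continuous_rot {φ : E3 → ℝ} (hφ : ContDiff ℝ 1 φ) (a : E3) :
    Continuous (rot a φ) :=
  (contDiff_rot (m := 0) hφ (by simp) a).continuous

theorem integral_rot_mul (a : E3) {f g : E3 → ℝ} (hf : ContDiff ℝ 1 f) (hg : ContDiff ℝ 1 g) :
    ∫ x : S2, rot a f x * g x ∂surfaceMeasure = - ∫ x : S2, f x * rot a g x ∂surfaceMeasure := by
  have h := integral_rot a (hf.mul hg)
  simp only [rot_mul a (hf.differentiable (by simp)) (hg.differentiable (by simp))] at h
  rw [integral_add (f := fun x : S2 => f x * rot a g x) (g := fun x : S2 => rot a f x * g x)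
    (integrable_of_continuous (continuous_restrict (hf.continuous.mul (continuous_rot hg a))))
    (integrable_of_continuous (continuous_restrict ((continuous_rot hf a).mul hg.continuous)))] at h
  linarith

theorem continuous_rot_rot {φ : E3 → ℝ} (hφ : ContDiff ℝ 2 φ) (a b : E3) :
    Continuous (rot a (rot b φ)) :=
  continuous_rot (contDiff_rot (m := 1) hφ (by norm_num) b) a

theorem continuous_adjointGenerator (γ : ℝ) (Ω : ℝ → E3) (t : ℝ) {p : E3 → ℝ}
    (hp : ContDiff ℝ 2 p) : Continuous (adjointGenerator γ Ω t p) :=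
  (continuous_const.mul (continuous_finsetSum _ fun _ _ => continuous_rot_rot hp _ _)).add
    (continuous_rot (hp.of_le (by norm_num)) _)

theorem continuous_sphereGenerator (γ : ℝ) (Ω : ℝ → E3) (t : ℝ) {φ : E3 → ℝ}
    (hφ : ContDiff ℝ 2 φ) : Continuous (sphereGenerator γ Ω t φ) := by
  rw [funext (sphereGenerator_eq γ Ω t hφ)]
  exact (continuous_const.mul (continuous_finsetSum _ fun _ _ => continuous_rot_rot hφ _ _)).sub
    (continuous_rot (hφ.of_le (by norm_num)) _)

/-- Each rotation field is skew, so its square is symmetric and only the first order term in Ω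
changes sign. -/
theorem integral_sphereGenerator_mul (γ : ℝ) (Ω : ℝ → E3) (t : ℝ) {φ p : E3 → ℝ}
    (hφ : ContDiff ℝ 2 φ) (hp : ContDiff ℝ 2 p) :
    ∫ x : S2, sphereGenerator γ Ω t φ x * p x ∂surfaceMeasure
      = ∫ x : S2, φ x * adjointGenerator γ Ω t p x ∂surfaceMeasure := by
  have hφ1 : ContDiff ℝ 1 φ := hφ.of_le (by norm_num)
  have hp1 : ContDiff ℝ 1 p := hp.of_le (by norm_num)
  have hk : ∀ a, ∫ x : S2, rot a (rot a φ) x * p x ∂surfaceMeasure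
      = ∫ x : S2, φ x * rot a (rot a p) x ∂surfaceMeasure := fun a => by
    rw [integral_rot_mul a (contDiff_rot hφ (by norm_num) a) hp1,
      integral_rot_mul a hφ1 (contDiff_rot hp (by norm_num) a), neg_neg]
  have iL : ∀ k, Integrable (fun x : S2 => rot (stdVec k) (rot (stdVec k) φ) x * p x)
      surfaceMeasure := fun k => integrable_of_continuous
    (continuous_restrict ((continuous_rot_rot hφ _ _).mul hp.continuous))
  have iR : ∀ k, Integrable (fun x : S2 => φ x * rot (stdVec k) (rot (stdVec k) p) x)
      surfaceMeasure := fun k => integrable_of_continuous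
    (continuous_restrict (hφ.continuous.mul (continuous_rot_rot hp _ _)))
  have iL' : Integrable (fun x : S2 => rot (Ω t) φ x * p x) surfaceMeasure :=
    integrable_of_continuous (continuous_restrict ((continuous_rot hφ1 _).mul hp.continuous))
  have iR' : Integrable (fun x : S2 => φ x * rot (Ω t) p x) surfaceMeasure :=
    integrable_of_continuous (continuous_restrict (hφ.continuous.mul (continuous_rot hp1 _)))
  have e1 : ∀ x : S2, sphereGenerator γ Ω t φ x * p x
      = γ ^ 2 / 2 * ∑ k, rot (stdVec k) (rot (stdVec k) φ) x * p x - rot (Ω t) φ x * p x := by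
    intro x
    rw [sphereGenerator_eq γ Ω t hφ, sub_mul, mul_assoc, Finset.sum_mul]
  have e2 : ∀ x : S2, φ x * adjointGenerator γ Ω t p x
      = γ ^ 2 / 2 * ∑ k, φ x * rot (stdVec k) (rot (stdVec k) p) x + φ x * rot (Ω t) p x := by
    intro x
    rw [adjointGenerator, mul_add, mul_left_comm, Finset.mul_sum]
  simp only [e1, e2]
  rw [integral_sub ((integrable_finsetSum _ fun k _ => iL k).const_mul _) iL',
    integral_add ((integrable_finsetSum _ fun k _ => iR k).const_mul _) iR',
    integral_const_mul, integral_const_mul, integral_finsetSum _ fun k _ => iL k,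
    integral_finsetSum _ fun k _ => iR k, integral_rot_mul _ hφ1 hp1]
  simp only [hk]
  ring

theorem contDiff_density (θ : E3) {n : WithTop ℕ∞} : ContDiff ℝ n (density θ) :=
  contDiff_exp_inner θ _

/-- The adjoint value of a von Mises–Fisher density. -/
def adjointDensity (γ : ℝ) (Ω : ℝ → E3) (t : ℝ) (η : E3) : C(S2, ℝ) :=
  ⟨fun x => adjointGenerator γ Ω t (density η) x,
    continuous_restrict (continuous_adjointGenerator γ Ω t (contDiff_density η))⟩

theorem isAdjointValue_adjointDensity (γ : ℝ) (Ω : ℝ → E3) (t : ℝ) (η : E3) :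
    IsAdjointValue γ Ω t (density η)
      (ContinuousMap.toLp 2 surfaceMeasure ℝ (adjointDensity γ Ω t η)) := by
  intro φ hφ
  rw [integral_sphereGenerator_mul γ Ω t hφ (contDiff_density η)]
  refine integral_congr_ae ?_
  filter_upwards [ContinuousMap.coeFn_toLp (p := 2) surfaceMeasure (𝕜 := ℝ)
    (adjointDensity γ Ω t η)] with x hx
  rw [hx]
  rfl

theorem sqrtDensity_sq (θ x : E3) : sqrtDensity θ x ^ 2 = density θ x :=
  Real.sq_sqrt (Real.exp_pos _).le

theorem density_pos (θ x : E3) : 0 < density θ x := Real.exp_pos _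

theorem sqrtDensity_pos (θ x : E3) : 0 < sqrtDensity θ x := Real.sqrt_pos.2 (density_pos θ x)

/-- The quotient stays an exponential of an affine form, so its logarithmic derivatives along
rotations are linear in x. -/
theorem sqrtDensity_sq_div_density (θ η : E3) :
    (fun y => sqrtDensity θ y ^ 2 / density η y)
      = fun y => Real.exp (inner ℝ (θ - η) y - (kappa ‖θ‖ - kappa ‖η‖)) := by
  funext y
  rw [sqrtDensity_sq, density, density, ← Real.exp_sub, inner_sub_left]
  ring_nf

theorem memLp_smoothingOperator (γ : ℝ) (Ω : ℝ → E3) (t : ℝ) (η θ : E3) :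
    MemLp (smoothingOperator γ Ω t η
      (ContinuousMap.toLp 2 surfaceMeasure ℝ (adjointDensity γ Ω t η)) (sqrtDensity θ)) 2
      surfaceMeasure := by
  have hc : Continuous fun x : S2 => sqrtDensity θ x / (2 * sqrtDensity θ x ^ 2) *
      (sqrtDensity θ x ^ 2 / density η x * adjointDensity γ Ω t η x
      - density η x * sphereGenerator γ Ω t (fun y => sqrtDensity θ y ^ 2 / density η y) x) := by
    have h1 := continuous_sqrtDensity θ
    have h2 := continuous_restrict (contDiff_density η (n := 0)).continuous
    have h3 : Continuous fun x : S2 =>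
        sphereGenerator γ Ω t (fun y => sqrtDensity θ y ^ 2 / density η y) x := by
      rw [sqrtDensity_sq_div_density]
      exact continuous_restrict (continuous_sphereGenerator γ Ω t (contDiff_exp_inner _ _))
    refine (h1.div (continuous_const.mul (h1.pow 2)) fun x => ?_).mul
      ((((h1.pow 2).div h2 fun x => (density_pos _ _).ne').mul (map_continuous _)).sub (h2.mul h3))
    have := sqrtDensity_pos θ x.1
    exact (by positivity : (0 : ℝ) < 2 * sqrtDensity θ x.1 ^ 2).ne'
  have hm : MemLp _ 2 surfaceMeasure := MemLp.of_bound hc.aestronglyMeasurable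
    (isCompact_univ (X := S2) |>.exists_bound_of_continuousOn hc.continuousOn).choose
    (Filter.Eventually.of_forall fun x =>
      (isCompact_univ (X := S2) |>.exists_bound_of_continuousOn hc.continuousOn).choose_spec x
        (Set.mem_univ x))
  refine hm.ae_eq ?_
  filter_upwards [ContinuousMap.coeFn_toLp (p := 2) surfaceMeasure (𝕜 := ℝ)
    (adjointDensity γ Ω t η)] with x hx
  rw [smoothingOperator, hx]

/-- The pairing of the smoothing operator with the functions `√p_θ (bᵀx - c)`. -/
theorem integral_smoothingOperator_mul (γ : ℝ) (Ω : ℝ → E3) (t : ℝ) (η θ : E3) {u : L2S2}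
    (hu : IsAdjointValue γ Ω t (density η) u) (b : E3) (c : ℝ) :
    ∫ x : S2, smoothingOperator γ Ω t η u (sqrtDensity θ) x
        * (sqrtDensity θ x * (inner ℝ b x.1 - c)) ∂surfaceMeasure
      = 1 / 2 * ∫ x : S2, density θ x * (-γ ^ 2 * inner ℝ b x.1 - inner ℝ b (cross (Ω t) x)
        + γ ^ 2 * (inner ℝ (θ - η) b - inner ℝ (θ - η) x.1 * inner ℝ b x.1)) ∂surfaceMeasure := by
  set g : E3 → ℝ := fun y => inner ℝ b y - c with hg
  set h : E3 → ℝ := fun y => Real.exp (inner ℝ (θ - η) y - (kappa ‖θ‖ - kappa ‖η‖)) with hh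
  have cg : ContDiff ℝ 2 g := contDiff_inner_sub b c
  have ch : ContDiff ℝ 2 h := contDiff_exp_inner _ _
  have cp := (contDiff_density η (n := 0)).continuous
  have e1 : ∀ x : S2, smoothingOperator γ Ω t η u (sqrtDensity θ) x
        * (sqrtDensity θ x * (inner ℝ b x.1 - c))
      = 1 / 2 * (h x * g x * u x - g x * sphereGenerator γ Ω t h x * density η x) := by
    intro x
    have hx := sqrtDensity_sq_div_density θ η
    have := sqrtDensity_pos θ x
    rw [smoothingOperator, hx, congrFun hx x]
    simp only [← hh]
    field_simp
    ring
  have hu2 : Integrable (fun x : S2 => h x * g x * u x) surfaceMeasure := by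
    have hc := continuous_restrict (ch.continuous.mul cg.continuous)
    obtain ⟨C, hC⟩ := (isCompact_univ (X := S2)).exists_bound_of_continuousOn hc.continuousOn
    exact ((Lp.memLp u).integrable (by norm_num)).bdd_mul hc.aestronglyMeasurable
      (c := C) (Filter.Eventually.of_forall fun x => hC x (Set.mem_univ x))
  have i2 : Integrable (fun x : S2 => g x * sphereGenerator γ Ω t h x * density η x)
      surfaceMeasure := integrable_of_continuous (continuous_restrict
    ((cg.continuous.mul (continuous_sphereGenerator γ Ω t ch)).mul cp))
  have i1 : Integrable (fun x : S2 => sphereGenerator γ Ω t (fun y => h y * g y) x * density η x)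
      surfaceMeasure := integrable_of_continuous (continuous_restrict
    ((continuous_sphereGenerator γ Ω t (ch.mul cg)).mul cp))
  simp only [e1]
  -- The adjoint relation, tested against hg, eliminates u; hence any admissible u gives the same
  -- pairing.
  rw [integral_const_mul, integral_sub hu2 i2, ← hu (fun y => h y * g y) (ch.mul cg),
    ← integral_sub i1 i2]
  congr 1
  refine integral_congr_ae (Filter.Eventually.of_forall fun x => ?_)
  have hd : density θ x = h x * density η x := by
    simp only [hh, density, ← Real.exp_add, inner_sub_left]
    ring_nf
  have hx : ‖(x : E3)‖ ^ 2 = 1 := by simp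
  -- In 𝒢[hg] - g𝒢[h] the term g𝒢[h] cancels, and both remaining terms carry a factor h, which
  -- combines with p_η to p_θ. The constant c disappears because g is only differentiated.
  simp only [sphereGenerator_mul γ Ω t ch cg, hd]
  rw [hg, hh, sphereGenerator_inner_sub]
  simp only [rot_exp_inner, rot_inner_sub, mul_assoc, ← Finset.mul_sum]
  rw [sum_inner_cross_stdVec, hx]
  ring

theorem contDiff_inner_cross (a b : E3) {n : WithTop ℕ∞} :
    ContDiff ℝ n fun y : E3 => inner ℝ b (cross a y) :=
  ((innerSL ℝ b).comp (crossL a)).contDiff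

/-! ### Exponential moments on the sphere -/

/-- The restriction of the linear form `θᵀ x` to the sphere. -/
def linForm : E3 →L[ℝ] C(S2, ℝ) :=
  LinearMap.toContinuousLinearMap
    { toFun := fun θ => ⟨fun x : S2 => inner ℝ θ x.1, by fun_prop⟩
      map_add' := fun a b => by ext x; simp [inner_add_left]
      map_smul' := fun c a => by ext x; simp [inner_smul_left] }

@[simp] theorem linForm_apply (θ : E3) (x : S2) : linForm θ x = inner ℝ θ x.1 := rfl

/-- The function `exp (θᵀ x)` on the sphere. -/
def expForm (θ : E3) : C(S2, ℝ) := NormedSpace.exp (linForm θ)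

@[simp] theorem expForm_apply (θ : E3) (x : S2) : expForm θ x = Real.exp (inner ℝ θ x.1) := by
  let _ : NormedAlgebra ℚ C(S2, ℝ) := NormedAlgebra.restrictScalars ℚ ℝ _
  have h := NormedSpace.map_exp (ContinuousMap.evalAlgHom ℝ ℝ x)
    (continuous_eval_const x) (linForm θ)
  rw [Real.exp_eq_exp_ℝ]
  exact h

/-- With the exponential taken in the Banach algebra of continuous functions, differentiating
moments under the integral reduces to the chain rule with bounded linear maps. -/
theorem hasStrictFDerivAt_expForm (θ : E3) :
    HasStrictFDerivAt expForm
      ((expForm θ • (1 : C(S2, ℝ) →L[ℝ] C(S2, ℝ))).comp linForm) θ :=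
  (hasStrictFDerivAt_exp (𝕂 := ℝ)).comp θ linForm.hasStrictFDerivAt

/-- Integration over the sphere as a continuous linear form on continuous functions. -/
def sphereIntegral : C(S2, ℝ) →L[ℝ] ℝ :=
  (innerSL ℝ (ContinuousMap.toLp 2 surfaceMeasure ℝ (1 : C(S2, ℝ)))).comp
    (ContinuousMap.toLp 2 surfaceMeasure ℝ)

theorem sphereIntegral_apply (f : C(S2, ℝ)) :
    sphereIntegral f = ∫ x, f x ∂surfaceMeasure := by
  simp only [sphereIntegral, ContinuousLinearMap.comp_apply, innerSL_apply_apply]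
  rw [ContinuousMap.inner_toLp]
  simp

theorem hasFDerivAt_moment (g : C(S2, ℝ)) (θ : E3) :
    HasFDerivAt (fun θ => sphereIntegral (g * expForm θ))
      (sphereIntegral.comp ((ContinuousLinearMap.mul ℝ C(S2, ℝ) g).comp
        ((expForm θ • (1 : C(S2, ℝ) →L[ℝ] C(S2, ℝ))).comp linForm))) θ :=
  (sphereIntegral.comp (ContinuousLinearMap.mul ℝ C(S2, ℝ) g)).hasFDerivAt.comp θ
    (hasStrictFDerivAt_expForm θ).hasFDerivAt

theorem hasDerivAt_moment (g : C(S2, ℝ)) (e : E3) (r : ℝ) :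
    HasDerivAt (fun r : ℝ => sphereIntegral (g * expForm (r • e)))
      (sphereIntegral ((g * linForm e) * expForm (r • e))) r := by
  have h := (hasFDerivAt_moment g (r • e)).comp_hasDerivAt r ((hasDerivAt_id r).smul_const e)
  refine h.congr_deriv ?_
  simp only [one_smul, ContinuousLinearMap.comp_apply, ContinuousLinearMap.mul_apply']
  congr 1
  ext x
  simp
  ring

/-- Linear forms are eigenfunctions of the sum of squared rotation fields, with eigenvalue -2, and
everything in its image has mean zero. -/
theorem integral_inner (b : E3) : ∫ x : S2, inner ℝ b x.1 ∂surfaceMeasure = 0 := by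
  have h : ∀ k, ∫ x : S2, inner ℝ b (cross (stdVec k) (cross (stdVec k) x.1)) ∂surfaceMeasure
      = 0 := fun k => by
    simp only [← rot_inner_cross]
    exact integral_rot _ (contDiff_inner_cross _ _)
  have hc : ∀ k, Integrable
      (fun x : S2 => inner ℝ b (cross (stdVec k) (cross (stdVec k) x.1))) surfaceMeasure :=
    fun k => integrable_of_continuous (continuous_restrict
      ((contDiff_inner_cross (n := 0) (stdVec k) b).comp (contDiff_crossL (stdVec k))).continuous)
  have hs := integral_finsetSum (μ := surfaceMeasure) Finset.univ fun k _ => hc k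
  simp only [h, Finset.sum_const_zero] at hs
  have e : ∀ x : S2, ∑ k, inner ℝ b (cross (stdVec k) (cross (stdVec k) x.1))
      = -2 * inner ℝ b x.1 := fun x => by
    simp only [Fin.sum_univ_three, inner_eq_three, cross_apply_zero, cross_apply_one,
      cross_apply_two]
    simp
    ring
  simp only [e, integral_const_mul] at hs
  linarith

/-- The integral of the spherical Laplacian of `exp (bᵀ x)` vanishes. -/
theorem integral_laplacian_exp (b : E3) :
    ∫ x : S2, Real.exp (inner ℝ b x.1) * (‖b‖ ^ 2 - inner ℝ b x.1 ^ 2 - 2 * inner ℝ b x.1)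
      ∂surfaceMeasure = 0 := by
  have hcd : ∀ k, ContDiff ℝ 1 fun y : E3 =>
      Real.exp (inner ℝ b y - 0) * inner ℝ b (cross (stdVec k) y) := fun k =>
    (contDiff_exp_inner b 0).mul (contDiff_inner_cross _ _)
  have hs := integral_finsetSum (μ := surfaceMeasure) Finset.univ fun k _ =>
    integrable_of_continuous (continuous_restrict (continuous_rot (hcd k) (stdVec k)))
  simp only [fun k => integral_rot (stdVec k) (hcd k), Finset.sum_const_zero] at hs
  rw [← hs]
  refine integral_congr_ae (Filter.Eventually.of_forall fun x => ?_)
  have key : ∀ k, rot (stdVec k)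
      (fun y => Real.exp (inner ℝ b y - 0) * inner ℝ b (cross (stdVec k) y)) x
      = Real.exp (inner ℝ b x.1) * (inner ℝ b (cross (stdVec k) (cross (stdVec k) x.1))
        + inner ℝ b (cross (stdVec k) x.1) * inner ℝ b (cross (stdVec k) x.1)) := fun k => by
    rw [rot_mul _ ((contDiff_exp_inner b 0 (n := 1)).differentiable (by simp))
      ((contDiff_inner_cross (n := 1) _ _).differentiable (by simp)), rot_inner_cross,
      rot_exp_inner, sub_zero]
    ring
  simp only [key, ← Finset.mul_sum]
  congr 1
  have h := sphere_sq_sum x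
  rw [norm_sq_eq_three]
  simp only [Fin.sum_univ_three, inner_eq_three, cross_apply_zero, cross_apply_one,
    cross_apply_two]
  simp
  linear_combination (-(b 0 ^ 2 + b 1 ^ 2 + b 2 ^ 2)) * h

theorem integral_one : ∫ _ : S2, (1 : ℝ) ∂surfaceMeasure = 4 * Real.pi := by
  rw [integral_const, surfaceMeasure, Measure.toSphere_real_apply_univ, measureReal_def,
    EuclideanSpace.volume_ball_fin_three]
  simp
  rw [ENNReal.toReal_ofReal (by positivity)]
  ring

/-- For r ≠ 0 this is `integral_laplacian_exp` at b = r e divided by r; at r = 0 it is the vanishing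
mean of a linear form. -/
theorem moment_ode {e : E3} (he : ‖e‖ = 1) (r : ℝ) :
    2 * sphereIntegral (linForm e * expForm (r • e))
      + r * sphereIntegral (linForm e * linForm e * expForm (r • e))
      = r * sphereIntegral (expForm (r • e)) := by
  rcases eq_or_ne r 0 with rfl | hr
  · simp [sphereIntegral_apply, integral_inner]
  · have h := integral_laplacian_exp (r • e)
    have h2 : r ^ 2 * sphereIntegral (expForm (r • e))
        - r ^ 2 * sphereIntegral (linForm e * linForm e * expForm (r • e))
        - 2 * r * sphereIntegral (linForm e * expForm (r • e)) = 0 := by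
      rw [← h]
      simp only [← smul_eq_mul, ← map_smul, ← map_sub]
      rw [sphereIntegral_apply]
      refine integral_congr_ae (Filter.Eventually.of_forall fun x => ?_)
      simp [norm_smul, he, inner_smul_left]
      ring
    apply mul_left_cancel₀ hr
    linarith

theorem mul_moment {e : E3} (he : ‖e‖ = 1) (r : ℝ) :
    r * sphereIntegral (expForm (r • e)) = 4 * Real.pi * Real.sinh r := by
  set f0 : ℝ → ℝ := fun r => sphereIntegral (expForm (r • e)) with hf0
  set f1 : ℝ → ℝ := fun r => sphereIntegral (linForm e * expForm (r • e)) with hf1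
  set f2 : ℝ → ℝ := fun r => sphereIntegral (linForm e * linForm e * expForm (r • e)) with hf2
  have d0 : ∀ r, HasDerivAt f0 (f1 r) r := fun r => by
    simpa using hasDerivAt_moment 1 e r
  have d1 : ∀ r, HasDerivAt f1 (f2 r) r := fun r => hasDerivAt_moment (linForm e) e r
  have ode : ∀ r, 2 * f1 r + r * f2 r = r * f0 r := moment_ode he
  have f00 : f0 0 = 4 * Real.pi := by
    simp only [hf0, sphereIntegral_apply]
    simpa using integral_one
  have dg : ∀ r, HasDerivAt (fun r => r * f0 r) (f0 r + r * f1 r) r := fun r => by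
    have h : HasDerivAt (fun r => r * f0 r) _ r := (hasDerivAt_id r).mul (d0 r)
    simpa using h
  have dg' : ∀ r, HasDerivAt (fun r => f0 r + r * f1 r) (r * f0 r) r := fun r => by
    have := (d0 r).add ((hasDerivAt_id r).mul (d1 r))
    refine this.congr_deriv ?_
    simp only [id, one_mul]
    linarith [ode r]
  -- With g = r f0 the ODE reads g'' = g. For σ = ±1 the function g' + σg satisfies y' = σy, so its
  -- product with exp(-σr) keeps its value f0(0) = 4π. The two cases together eliminate g'.
  have key : ∀ σ : ℝ, σ ^ 2 = 1 → ∀ r,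
      (f0 r + r * f1 r + σ * (r * f0 r)) * Real.exp (-σ * r) = 4 * Real.pi := by
    intro σ hσ r
    have dd : ∀ r, HasDerivAt
        (fun r => (f0 r + r * f1 r + σ * (r * f0 r)) * Real.exp (-σ * r)) 0 r := fun r => by
      have h2 : HasDerivAt (fun r => Real.exp (-σ * r)) (Real.exp (-σ * r) * (-σ)) r := by
        simpa using ((hasDerivAt_id r).const_mul (-σ)).exp
      refine (((dg' r).add ((dg r).const_mul σ)).mul h2).congr_deriv ?_
      simp only [Pi.add_apply]
      linear_combination (-(r * f0 r) * Real.exp (-σ * r)) * hσ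
    have := is_const_of_deriv_eq_zero (fun r => (dd r).differentiableAt)
      (fun r => (dd r).deriv) r 0
    rw [this]
    simp [f00]
  have k1 := key 1 (by norm_num) r
  have k2 := key (-1) (by norm_num) r
  have e1 : Real.exp r * Real.exp (-r) = 1 := by rw [← Real.exp_add]; simp
  rw [Real.sinh_eq]
  simp only [neg_neg, one_mul, neg_mul] at k1 k2
  linear_combination (Real.exp r / 2) * k1 - (Real.exp (-r) / 2) * k2 - (r * f0 r) * e1

theorem exp_kappa {r : ℝ} (hr : 0 < r) : Real.exp (kappa r) = 4 * Real.pi * Real.sinh r / r := by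
  have hs := Real.sinh_pos_iff.2 hr
  rw [kappa, Real.exp_add, Real.exp_add, Real.exp_neg, Real.exp_log hr,
    Real.exp_log (by positivity), Real.exp_log hs]
  field_simp

theorem sphereIntegral_expForm (θ : E3) :
    sphereIntegral (expForm θ) = Real.exp (kappa ‖θ‖) := by
  rcases eq_or_ne θ 0 with rfl | hθ
  · rw [sphereIntegral_apply]
    -- Since `Real.log 0 = 0`, `kappa 0` is log(4π), the correct limit value.
    simp [kappa, Real.exp_log (show (0 : ℝ) < 4 * Real.pi by positivity)]
    simpa using integral_one
  · have hr := norm_pos_iff.2 hθ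
    have h := mul_moment (e := ‖θ‖⁻¹ • θ) (by rw [norm_smul]; simp [hr.ne']) ‖θ‖
    rw [smul_inv_smul₀ hr.ne'] at h
    rw [exp_kappa hr, ← h]
    field_simp

/-! ### Derivatives of the log-normalizer -/

/-- The Langevin function `coth r - 1 / r`. -/
def langevin (r : ℝ) : ℝ := Real.cosh r / Real.sinh r - 1 / r

theorem hasStrictDerivAt_kappa {r : ℝ} (hr : 0 < r) : HasStrictDerivAt kappa (langevin r) r := by
  have hs := Real.sinh_pos_iff.2 hr
  have h := (((Real.hasStrictDerivAt_log hr.ne').neg).add_const (Real.log (4 * Real.pi))).add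
    ((Real.hasStrictDerivAt_sinh r).log hs.ne')
  refine HasStrictDerivAt.congr_deriv h ?_
  rw [langevin]; ring

theorem hasDerivAt_kappa {r : ℝ} (hr : 0 < r) : HasDerivAt kappa (langevin r) r :=
  (hasStrictDerivAt_kappa hr).hasDerivAt

theorem hasDerivAt_langevin {r : ℝ} (hr : 0 < r) :
    HasDerivAt langevin (1 / r ^ 2 - 1 / Real.sinh r ^ 2) r := by
  have hs := Real.sinh_pos_iff.2 hr
  have h := ((Real.hasDerivAt_cosh r).div (Real.hasDerivAt_sinh r) hs.ne').sub
    ((hasDerivAt_inv hr.ne'))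
  have h2 : Real.cosh / Real.sinh - (fun y => y⁻¹) = langevin := by
    funext s; simp [langevin]
  rw [← h2]
  refine h.congr_deriv ?_
  have := Real.cosh_sq r
  field_simp
  rw [this]; ring

theorem deriv_kappa {r : ℝ} (hr : 0 < r) : deriv kappa r = langevin r :=
  (hasDerivAt_kappa hr).deriv

theorem deriv_deriv_kappa {r : ℝ} (hr : 0 < r) :
    deriv (deriv kappa) r = 1 / r ^ 2 - 1 / Real.sinh r ^ 2 := by
  have : deriv kappa =ᶠ[nhds r] langevin := by
    filter_upwards [lt_mem_nhds hr] with s hs using deriv_kappa hs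
  rw [this.deriv_eq, (hasDerivAt_langevin hr).deriv]

theorem deriv_deriv_kappa_pos {r : ℝ} (hr : 0 < r) : 0 < deriv (deriv kappa) r := by
  rw [deriv_deriv_kappa hr, sub_pos]
  have := Real.self_lt_sinh_iff.2 hr
  exact one_div_lt_one_div_of_lt (by positivity) (by gcongr)

theorem hasDerivAt_langevin' {r : ℝ} (hr : 0 < r) :
    HasDerivAt langevin (deriv (deriv kappa) r) r := by
  rw [deriv_deriv_kappa hr]; exact hasDerivAt_langevin hr

/-- Division by zero returns 0, which agrees with the limit of coth r - 1/r at 0. -/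
theorem langevin_zero : langevin 0 = 0 := by simp [langevin]

theorem sinh_lt_mul_cosh {r : ℝ} (hr : 0 < r) : Real.sinh r < r * Real.cosh r := by
  have hd : ∀ s, HasDerivAt (fun s => s * Real.cosh s - Real.sinh s) (s * Real.sinh s) s := by
    intro s
    refine (((hasDerivAt_id s).mul (Real.hasDerivAt_cosh s)).sub
      (Real.hasDerivAt_sinh s)).congr_deriv ?_
    simp
  have hm := strictMonoOn_of_deriv_pos (convex_Ici (0 : ℝ))
    (f := fun s => s * Real.cosh s - Real.sinh s)
    (fun s _ => (hd s).continuousAt.continuousWithinAt) (fun s hs => by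
      rw [interior_Ici] at hs
      rw [(hd s).deriv]
      exact mul_pos hs (Real.sinh_pos_iff.2 hs))
  have := hm (Set.mem_Ici.2 le_rfl) (Set.mem_Ici.2 hr.le) hr
  simp at this
  linarith

theorem langevin_pos {r : ℝ} (hr : 0 < r) : 0 < langevin r := by
  have hs := Real.sinh_pos_iff.2 hr
  rw [langevin, sub_pos, div_lt_div_iff₀ hr hs]
  linarith [sinh_lt_mul_cosh hr]

theorem langevin_strictMonoOn : StrictMonoOn langevin (Set.Ici 0) := by
  have h : StrictMonoOn langevin (Set.Ioi 0) :=
    strictMonoOn_of_deriv_pos (convex_Ioi 0)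
      (fun s hs => (hasDerivAt_langevin' hs).continuousAt.continuousWithinAt) fun s hs => by
        rw [interior_Ioi] at hs
        rw [(hasDerivAt_langevin' hs).deriv]
        exact deriv_deriv_kappa_pos hs
  intro a ha b hb hab
  rcases (Set.mem_Ici.1 ha).eq_or_lt with rfl | ha'
  · rw [langevin_zero]; exact langevin_pos hab
  · exact h ha' (ha'.trans hab) hab

/-! ### Moments of the von Mises–Fisher density -/

theorem hasStrictFDerivAt_norm {θ : E3} (hθ : θ ≠ 0) :
    HasStrictFDerivAt (fun θ : E3 => ‖θ‖) (‖θ‖⁻¹ • innerSL ℝ θ) θ := by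
  have hr := norm_pos_iff.2 hθ
  have h := (Real.hasStrictDerivAt_sqrt (x := ‖θ‖ ^ 2) (by positivity)).comp_hasStrictFDerivAt θ
    (hasStrictFDerivAt_norm_sq θ)
  simp only [Function.comp_def, Real.sqrt_sq (norm_nonneg _)] at h
  refine h.congr_fderiv ?_
  ext v
  simp
  field_simp

theorem hasFDerivAt_langevin_norm_div {θ : E3} (hθ : θ ≠ 0) :
    HasFDerivAt (fun θ : E3 => langevin ‖θ‖ / ‖θ‖)
      (((deriv (deriv kappa) ‖θ‖ - langevin ‖θ‖ / ‖θ‖) / ‖θ‖ ^ 2) • innerSL ℝ θ) θ := by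
  have hr := norm_pos_iff.2 hθ
  have h := ((hasDerivAt_langevin' hr).div (hasDerivAt_id ‖θ‖) hr.ne').comp_hasFDerivAt θ
    (hasStrictFDerivAt_norm hθ).hasFDerivAt
  refine (h : HasFDerivAt (fun θ : E3 => langevin ‖θ‖ / ‖θ‖) _ θ).congr_fderiv ?_
  ext v
  simp
  field_simp

theorem hasFDerivAt_exp_kappa_norm {θ : E3} (hθ : θ ≠ 0) :
    HasFDerivAt (fun θ : E3 => Real.exp (kappa ‖θ‖))
      ((Real.exp (kappa ‖θ‖) * (langevin ‖θ‖ / ‖θ‖)) • innerSL ℝ θ) θ := by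
  have hr := norm_pos_iff.2 hθ
  have h := ((hasDerivAt_kappa hr).exp).comp_hasFDerivAt θ
    (hasStrictFDerivAt_norm hθ).hasFDerivAt
  refine (h : HasFDerivAt (fun θ : E3 => Real.exp (kappa ‖θ‖)) _ θ).congr_fderiv ?_
  ext v
  simp
  field_simp

/-- Differentiate the partition function exp κ(‖θ‖) in the direction a; differentiating once more
gives the second moments. -/
theorem sphereIntegral_linForm_expForm (θ a : E3) :
    sphereIntegral (linForm a * expForm θ)
      = Real.exp (kappa ‖θ‖) * (langevin ‖θ‖ / ‖θ‖) * inner ℝ θ a := by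
  rcases eq_or_ne θ 0 with rfl | hθ
  · simp [sphereIntegral_apply, integral_inner]
  have h1 := hasFDerivAt_moment 1 θ
  simp only [one_mul, sphereIntegral_expForm] at h1
  have h2 := DFunLike.congr_fun (h1.unique (hasFDerivAt_exp_kappa_norm hθ)) a
  simp only [ContinuousLinearMap.comp_apply, ContinuousLinearMap.mul_apply', one_mul,
    smul_apply, innerSL_apply_apply, one_apply_eq_self, smul_eq_mul] at h2
  rw [← h2, mul_comm]

theorem sphereIntegral_linForm_linForm_expForm {θ : E3} (hθ : θ ≠ 0) (a b : E3) :
    sphereIntegral (linForm a * linForm b * expForm θ)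
      = Real.exp (kappa ‖θ‖) * (langevin ‖θ‖ / ‖θ‖ * inner ℝ a b
        + (deriv (deriv kappa) ‖θ‖ - langevin ‖θ‖ / ‖θ‖ + langevin ‖θ‖ ^ 2) / ‖θ‖ ^ 2
          * (inner ℝ θ a * inner ℝ θ b)) := by
  have hr := norm_pos_iff.2 hθ
  have h1 := hasFDerivAt_moment (linForm a) θ
  simp only [sphereIntegral_linForm_expForm] at h1
  have h3 : HasFDerivAt (fun θ => inner ℝ θ a) (innerSL ℝ a) θ := by
    simpa [real_inner_comm] using (innerSL ℝ a).hasFDerivAt (x := θ)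
  have h2 := DFunLike.congr_fun (h1.unique
    (((hasFDerivAt_exp_kappa_norm hθ).mul (hasFDerivAt_langevin_norm_div hθ)).mul h3)) b
  simp only [ContinuousLinearMap.comp_apply, ContinuousLinearMap.mul_apply',
    smul_apply, innerSL_apply_apply, one_apply_eq_self, smul_eq_mul,
    add_apply] at h2
  rw [mul_assoc, mul_comm (linForm b), h2]
  simp only [Pi.mul_apply]
  field_simp

theorem density_eq_mul_expForm (θ : E3) (x : S2) :
    density θ x = Real.exp (-kappa ‖θ‖) * expForm θ x := by
  rw [density, expForm_apply, ← Real.exp_add]; ring_nf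

theorem integral_density_mul (θ : E3) (f : C(S2, ℝ)) :
    ∫ x : S2, density θ x * f x ∂surfaceMeasure
      = Real.exp (-kappa ‖θ‖) * sphereIntegral (f * expForm θ) := by
  rw [sphereIntegral_apply, ← integral_const_mul]
  congr 1
  ext x
  rw [density_eq_mul_expForm, ContinuousMap.mul_apply]; ring

theorem exp_neg_mul_exp_mul (k c : ℝ) : Real.exp (-k) * (Real.exp k * c) = c := by
  rw [← mul_assoc, ← Real.exp_add]; simp

theorem integral_density (θ : E3) : ∫ x : S2, density θ x ∂surfaceMeasure = 1 := by
  have h := integral_density_mul θ 1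
  rw [one_mul, sphereIntegral_expForm] at h
  have h2 := exp_neg_mul_exp_mul (kappa ‖θ‖) 1
  simp only [mul_one] at h2
  simpa [h2] using h

theorem integral_density_inner (θ a : E3) :
    ∫ x : S2, density θ x * inner ℝ a x.1 ∂surfaceMeasure
      = langevin ‖θ‖ / ‖θ‖ * inner ℝ θ a := by
  have h := integral_density_mul θ (linForm a)
  rw [sphereIntegral_linForm_expForm, mul_assoc, exp_neg_mul_exp_mul] at h
  exact h

theorem integral_density_inner_inner {θ : E3} (hθ : θ ≠ 0) (a b : E3) :
    ∫ x : S2, density θ x * (inner ℝ a x.1 * inner ℝ b x.1) ∂surfaceMeasure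
      = langevin ‖θ‖ / ‖θ‖ * inner ℝ a b
        + (deriv (deriv kappa) ‖θ‖ - langevin ‖θ‖ / ‖θ‖ + langevin ‖θ‖ ^ 2) / ‖θ‖ ^ 2
          * (inner ℝ θ a * inner ℝ θ b) := by
  have h := integral_density_mul θ (linForm a * linForm b)
  rw [sphereIntegral_linForm_linForm_expForm hθ, exp_neg_mul_exp_mul] at h
  exact h

theorem continuous_density_mul (θ : E3) {f : S2 → ℝ} (hf : Continuous f) :
    Continuous fun x : S2 => density θ x * f x :=
  (continuous_restrict (contDiff_density θ (n := 0)).continuous).mul hf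

theorem integral_linear_combination {f₁ f₂ f₃ f₄ : S2 → ℝ} (h₁ : Integrable f₁ surfaceMeasure)
    (h₂ : Integrable f₂ surfaceMeasure) (h₃ : Integrable f₃ surfaceMeasure)
    (h₄ : Integrable f₄ surfaceMeasure) (c₁ c₂ c₃ c₄ : ℝ) :
    ∫ x, (c₁ * f₁ x + c₂ * f₂ x + c₃ * f₃ x + c₄ * f₄ x) ∂surfaceMeasure
      = c₁ * ∫ x, f₁ x ∂surfaceMeasure + c₂ * ∫ x, f₂ x ∂surfaceMeasure
        + c₃ * ∫ x, f₃ x ∂surfaceMeasure + c₄ * ∫ x, f₄ x ∂surfaceMeasure := by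
  have i₁ := h₁.const_mul c₁
  have i₂ := h₂.const_mul c₂
  have i₃ := h₃.const_mul c₃
  have i₄ := h₄.const_mul c₄
  have i₁₂ : Integrable (fun x => c₁ * f₁ x + c₂ * f₂ x) surfaceMeasure := i₁.add i₂
  have i₁₂₃ : Integrable (fun x => c₁ * f₁ x + c₂ * f₂ x + c₃ * f₃ x) surfaceMeasure :=
    i₁₂.add i₃
  rw [integral_add i₁₂₃ i₄, integral_add i₁₂ i₃, integral_add i₁ i₂]
  simp only [integral_const_mul]

/-! ### The family of square root densities in `L²` -/

theorem sqrtDensity_eq (θ x : E3) :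
    sqrtDensity θ x = Real.exp (-(kappa ‖θ‖ / 2)) * Real.exp (inner ℝ ((1 / 2 : ℝ) • θ) x) := by
  rw [sqrtDensity, density, ← Real.exp_add, ← Real.exp_half]
  congr 1
  rw [inner_smul_left]
  simp
  ring

theorem sqrtDensityL2_eq (θ : E3) :
    sqrtDensityL2 θ = ContinuousMap.toLp 2 surfaceMeasure ℝ
      (Real.exp (-(kappa ‖θ‖ / 2)) • expForm ((1 / 2 : ℝ) • θ)) := by
  rw [sqrtDensityL2]
  congr 1
  ext x
  simp only [ContinuousMap.coe_mk, ContinuousMap.smul_apply, expForm_apply, smul_eq_mul]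
  exact sqrtDensity_eq θ x

/-- The derivative `½ √p_θ (vᵀx - κ'(‖θ‖) θᵀv / ‖θ‖)` of `√p_θ` in the direction `v`. -/
def sqrtDensityDeriv (θ : E3) : E3 →L[ℝ] C(S2, ℝ) :=
  LinearMap.toContinuousLinearMap
    { toFun := fun v => ⟨fun x : S2 => 1 / 2 * (sqrtDensity θ x *
        (inner ℝ v x.1 - langevin ‖θ‖ / ‖θ‖ * inner ℝ θ v)), by
          have := continuous_sqrtDensity θ
          fun_prop⟩
      map_add' := fun a b => by ext x; simp [inner_add_left, inner_add_right]; ring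
      map_smul' := fun c a => by ext x; simp [inner_smul_left, inner_smul_right]; ring }

theorem sqrtDensityDeriv_apply (θ v : E3) (x : S2) :
    sqrtDensityDeriv θ v x = 1 / 2 * (sqrtDensity θ x *
        (inner ℝ v x.1 - langevin ‖θ‖ / ‖θ‖ * inner ℝ θ v)) := rfl

/-- The derivative of `θ ↦ √p_θ ∈ L²(𝕊², λ)`. -/
def sqrtDensityL2Deriv (θ : E3) : E3 →L[ℝ] L2S2 :=
  (ContinuousMap.toLp 2 surfaceMeasure ℝ).comp (sqrtDensityDeriv θ)

theorem hasStrictFDerivAt_sqrtDensityL2 {θ : E3} (hθ : θ ≠ 0) :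
    HasStrictFDerivAt sqrtDensityL2 (sqrtDensityL2Deriv θ) θ := by
  have hr := norm_pos_iff.2 hθ
  have h1 : HasStrictFDerivAt (fun θ : E3 => kappa ‖θ‖)
      (langevin ‖θ‖ • (‖θ‖⁻¹ • innerSL ℝ θ)) θ :=
    (hasStrictDerivAt_kappa hr).comp_hasStrictFDerivAt θ (hasStrictFDerivAt_norm hθ)
  have h2 := ((h1.mul_const (1 / 2 : ℝ)).neg).exp
  have h3 := (hasStrictFDerivAt_expForm ((1 / 2 : ℝ) • θ)).comp θ
    ((hasStrictFDerivAt_id (𝕜 := ℝ) θ).const_smul (1 / 2 : ℝ))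
  let T : C(S2, ℝ) →L[ℝ] L2S2 := ContinuousMap.toLp 2 surfaceMeasure ℝ
  have h4 := T.hasStrictFDerivAt.comp θ (h2.smul h3)
  refine (h4.congr_of_eventuallyEq (Filter.Eventually.of_forall fun y => ?_)).congr_fderiv ?_
  · rw [sqrtDensityL2_eq]
    simp [T, div_eq_mul_inv]
  ext1 v
  simp only [sqrtDensityL2Deriv, ContinuousLinearMap.comp_apply]
  congr 1
  ext x
  rw [sqrtDensityDeriv_apply, sqrtDensity_eq]
  simp [inner_smul_left]
  ring_nf

/-- This is a quarter of the covariance of x under p_θ, the Fisher information: subtracting the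
squared mean cancels the `langevin`² term and leaves the Hessian of κ(‖θ‖). -/
theorem inner_sqrtDensityL2Deriv {θ : E3} (hθ : θ ≠ 0) (v w : E3) :
    inner ℝ (sqrtDensityL2Deriv θ v) (sqrtDensityL2Deriv θ w)
      = 1 / 4 * (langevin ‖θ‖ / ‖θ‖ * inner ℝ v w
        + (deriv (deriv kappa) ‖θ‖ - langevin ‖θ‖ / ‖θ‖) / ‖θ‖ ^ 2
          * (inner ℝ θ v * inner ℝ θ w)) := by
  have hr := norm_pos_iff.2 hθ
  rw [sqrtDensityL2Deriv, ContinuousLinearMap.comp_apply, ContinuousLinearMap.comp_apply,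
    ContinuousMap.inner_toLp]
  set α := langevin ‖θ‖ / ‖θ‖ with hα
  have e : ∀ x : S2, sqrtDensityDeriv θ w x * (starRingEnd ℝ) (sqrtDensityDeriv θ v x)
      = 1 / 4 * (density θ x * (inner ℝ v x.1 * inner ℝ w x.1))
        + -(1 / 4 * (α * inner ℝ θ v)) * (density θ x * inner ℝ w x.1)
        + -(1 / 4 * (α * inner ℝ θ w)) * (density θ x * inner ℝ v x.1)
        + 1 / 4 * (α * inner ℝ θ v * (α * inner ℝ θ w)) * density θ x := fun x => by
    rw [sqrtDensityDeriv_apply, sqrtDensityDeriv_apply, ← sqrtDensity_sq]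
    simp only [conj_trivial, ← hα]
    ring
  have i1 := integrable_of_continuous (continuous_density_mul θ
    (f := fun x : S2 => inner ℝ v x.1 * inner ℝ w x.1) (by fun_prop))
  have i2 := fun a : E3 => integrable_of_continuous (continuous_density_mul θ
    (f := fun x : S2 => inner ℝ a x.1) (by fun_prop))
  have i3 := integrable_of_continuous
    (continuous_restrict (contDiff_density θ (n := 0)).continuous)
  simp only [e]
  rw [integral_linear_combination i1 (i2 w) (i2 v) i3, integral_density_inner_inner hθ, integral_density_inner, integral_density_inner,
    integral_density, ← hα]
  have : langevin ‖θ‖ = α * ‖θ‖ := by rw [hα]; field_simp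
  rw [this]
  field_simp
  ring

/-- The pairing of the smoothing operator with the tangent vectors. -/
theorem inner_smoothingOperator (γ : ℝ) (Ω : ℝ → E3) (t : ℝ) (η : E3) {θ : E3} (hθ : θ ≠ 0)
    {u : L2S2} (hu : IsAdjointValue γ Ω t (density η) u)
    (hB : MemLp (smoothingOperator γ Ω t η u (sqrtDensity θ)) 2 surfaceMeasure) (v : E3) :
    inner ℝ (hB.toLp _) (sqrtDensityL2Deriv θ v)
      = 1 / 4 * (-(γ ^ 2 * (langevin ‖θ‖ / ‖θ‖)) * inner ℝ θ v
        - langevin ‖θ‖ / ‖θ‖ * inner ℝ (cross (Ω t) θ) v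
        + γ ^ 2 * inner ℝ (θ - η) v
        - γ ^ 2 * (langevin ‖θ‖ / ‖θ‖ * inner ℝ (θ - η) v
          + (deriv (deriv kappa) ‖θ‖ - langevin ‖θ‖ / ‖θ‖ + langevin ‖θ‖ ^ 2) / ‖θ‖ ^ 2
            * (inner ℝ θ (θ - η) * inner ℝ θ v))) := by
  have h1 : inner ℝ (hB.toLp _) (sqrtDensityL2Deriv θ v)
      = 1 / 2 * ∫ x : S2, smoothingOperator γ Ω t η u (sqrtDensity θ) x
        * (sqrtDensity θ x * (inner ℝ v x.1 - langevin ‖θ‖ / ‖θ‖ * inner ℝ θ v))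
          ∂surfaceMeasure := by
    rw [L2.inner_def, ← integral_const_mul]
    refine integral_congr_ae ?_
    filter_upwards [hB.coeFn_toLp, ContinuousMap.coeFn_toLp (p := 2) surfaceMeasure (𝕜 := ℝ)
      (sqrtDensityDeriv θ v)] with x hx1 hx2
    rw [hx1, sqrtDensityL2Deriv, ContinuousLinearMap.comp_apply, hx2, sqrtDensityDeriv_apply]
    simp
    ring
  rw [h1, integral_smoothingOperator_mul γ Ω t η θ hu]
  have e : ∀ x : S2, density θ x * (-γ ^ 2 * inner ℝ v x.1 - inner ℝ v (cross (Ω t) x)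
        + γ ^ 2 * (inner ℝ (θ - η) v - inner ℝ (θ - η) x.1 * inner ℝ v x.1))
      = -γ ^ 2 * (density θ x * inner ℝ v x.1) + 1 * (density θ x * inner ℝ (cross (Ω t) v) x.1)
        + γ ^ 2 * inner ℝ (θ - η) v * density θ x
        + -γ ^ 2 * (density θ x * (inner ℝ (θ - η) x.1 * inner ℝ v x.1)) := fun x => by
    rw [inner_cross_left]
    ring
  have i1 := integrable_of_continuous (continuous_density_mul θ
    (f := fun x : S2 => inner ℝ (θ - η) x.1 * inner ℝ v x.1) (by fun_prop))
  have i2 := fun a : E3 => integrable_of_continuous (continuous_density_mul θ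
    (f := fun x : S2 => inner ℝ a x.1) (by fun_prop))
  have i3 := integrable_of_continuous
    (continuous_restrict (contDiff_density θ (n := 0)).continuous)
  simp only [e]
  rw [integral_linear_combination (i2 v) (i2 _) i3 i1, integral_density_inner_inner hθ, integral_density_inner, integral_density_inner,
    integral_density, inner_cross_left (Ω t) θ v]
  ring

/-! ### The information matrix -/

/-- The Gram operator `D* D` of the derivative `D` of `θ ↦ √p_θ`. -/
def gramL (θ : E3) : E3 →L[ℝ] E3 :=
  (ContinuousLinearMap.adjoint (sqrtDensityL2Deriv θ)).comp (sqrtDensityL2Deriv θ)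

theorem gramL_apply {θ : E3} (hθ : θ ≠ 0) (v : E3) :
    gramL θ v = (1 / 4 * (langevin ‖θ‖ / ‖θ‖)) • v
      + (1 / 4 * ((deriv (deriv kappa) ‖θ‖ - langevin ‖θ‖ / ‖θ‖) / ‖θ‖ ^ 2) * inner ℝ θ v) • θ := by
  refine ext_inner_right ℝ fun w => ?_
  rw [gramL, ContinuousLinearMap.comp_apply, ContinuousLinearMap.adjoint_inner_left,
    inner_sqrtDensityL2Deriv hθ]
  simp only [inner_add_left, inner_smul_left, conj_trivial]
  ring

/-- The Gram operator as a linear equivalence. -/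
def gramEquiv {θ : E3} (hθ : θ ≠ 0) : E3 ≃L[ℝ] E3 :=
  (LinearEquiv.ofInjectiveEndo (gramL θ : E3 →ₗ[ℝ] E3) (by
    have hr := norm_pos_iff.2 hθ
    have hL := langevin_pos hr
    have hk := deriv_deriv_kappa_pos hr
    rw [← LinearMap.ker_eq_bot, LinearMap.ker_eq_bot']
    intro v hv
    change gramL θ v = 0 at hv
    rw [gramL_apply hθ] at hv
    -- Pairing with θ isolates the eigenvalue κ''/4, so a kernel vector is orthogonal to θ; there
    -- the eigenvalue is κ'/(4‖θ‖).
    have h1 : inner ℝ θ v = 0 := by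
      have h2 := congrArg (inner ℝ θ) hv
      simp only [inner_add_right, inner_smul_right, real_inner_self_eq_norm_sq,
        inner_zero_right] at h2
      field_simp at h2
      simpa [hk.ne', hθ] using h2
    rw [h1, mul_zero, zero_smul, add_zero] at hv
    exact (smul_eq_zero.1 hv).resolve_left (by positivity))).toContinuousLinearEquiv

/-- The right-hand side of the parameter equation of the projection smoother. -/
def smootherField (γ : ℝ) (Ω : ℝ → E3) (t : ℝ) (η θ : E3) : E3 :=
  -cross (Ω t) θ - (γ ^ 2 * deriv kappa ‖θ‖ / (‖θ‖ * deriv (deriv kappa) ‖θ‖)) • θ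
    + WithLp.toLp 2 ((gainMatrix γ θ).mulVec (θ - η).ofLp)

theorem projPar_mulVec (θ v : E3) :
    WithLp.toLp 2 ((projPar θ).mulVec v.ofLp) = (inner ℝ θ v / ‖θ‖ ^ 2) • θ := by
  rw [projPar, Matrix.smul_mulVec, Matrix.vecMulVec_mulVec, inner_eq_three]
  ext i
  simp [dotProduct, Fin.sum_univ_three]
  ring

theorem gainMatrix_mulVec (γ : ℝ) (θ v : E3) :
    WithLp.toLp 2 ((gainMatrix γ θ).mulVec v.ofLp)
      = (γ ^ 2 * ‖θ‖ / deriv kappa ‖θ‖) • (v - (inner ℝ θ v / ‖θ‖ ^ 2) • θ)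
        + (γ ^ 2 * (1 - deriv kappa ‖θ‖ ^ 2) / deriv (deriv kappa) ‖θ‖)
          • (inner ℝ θ v / ‖θ‖ ^ 2) • θ - γ ^ 2 • v := by
  rw [← projPar_mulVec]
  simp only [gainMatrix, projPerp, Matrix.add_mulVec, Matrix.sub_mulVec, Matrix.smul_mulVec,
    Matrix.one_mulVec, WithLp.toLp_add, WithLp.toLp_sub, WithLp.toLp_smul, WithLp.toLp_ofLp]

theorem inner_cross_self (a θ : E3) : inner ℝ θ (cross a θ) = 0 := by
  simp only [inner_eq_three, cross_apply_zero, cross_apply_one, cross_apply_two]; ring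

/-- Across θ, the factor κ'/‖θ‖ cancels the gain γ²‖θ‖/κ'; along θ, κ'' cancels the denominators.
The term -γ² I of the gain accounts for the first order part of the second moment. -/
theorem gramL_smootherField (γ : ℝ) (Ω : ℝ → E3) (t : ℝ) (η : E3) {θ : E3} (hθ : θ ≠ 0) :
    gramL θ (smootherField γ Ω t η θ)
      = (1 / 4 : ℝ) • (-(γ ^ 2 * (langevin ‖θ‖ / ‖θ‖)) • θ
        - (langevin ‖θ‖ / ‖θ‖) • cross (Ω t) θ + γ ^ 2 • (θ - η)
        - γ ^ 2 • ((langevin ‖θ‖ / ‖θ‖) • (θ - η)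
          + ((deriv (deriv kappa) ‖θ‖ - langevin ‖θ‖ / ‖θ‖ + langevin ‖θ‖ ^ 2) / ‖θ‖ ^ 2
            * inner ℝ θ (θ - η)) • θ)) := by
  have hr := norm_pos_iff.2 hθ
  have hL := langevin_pos hr
  have hk := deriv_deriv_kappa_pos hr
  rw [gramL_apply hθ, smootherField, gainMatrix_mulVec, deriv_kappa hr]
  generalize θ - η = δ
  simp only [inner_add_right, inner_sub_right, inner_neg_right, inner_smul_right,
    real_inner_self_eq_norm_sq, inner_cross_self]
  generalize inner ℝ θ δ = s
  generalize deriv (deriv kappa) ‖θ‖ = k at *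
  generalize langevin ‖θ‖ = l at *
  generalize cross (Ω t) θ = w
  generalize ‖θ‖ = r at *
  match_scalars <;> field_simp
  ring

theorem inner_smoothingOperator_eq (γ : ℝ) (Ω : ℝ → E3) (t : ℝ) (η : E3) {θ : E3} (hθ : θ ≠ 0)
    {u : L2S2} (hu : IsAdjointValue γ Ω t (density η) u)
    (hB : MemLp (smoothingOperator γ Ω t η u (sqrtDensity θ)) 2 surfaceMeasure) (v : E3) :
    inner ℝ (hB.toLp _) (sqrtDensityL2Deriv θ v)
      = inner ℝ (sqrtDensityL2Deriv θ (smootherField γ Ω t η θ)) (sqrtDensityL2Deriv θ v) := by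
  have h := ContinuousLinearMap.adjoint_inner_left (sqrtDensityL2Deriv θ) v
    (sqrtDensityL2Deriv θ (smootherField γ Ω t η θ))
  change inner ℝ (gramL θ (smootherField γ Ω t η θ)) v = _ at h
  rw [← h, gramL_smootherField _ _ _ _ hθ, inner_smoothingOperator γ Ω t η hθ hu]
  simp only [inner_smul_left, inner_add_left, inner_sub_left, conj_trivial, neg_mul,
    inner_neg_left, neg_smul]
  ring

theorem tangentSpace_eq_range {θ : E3} (hθ : θ ≠ 0) :
    tangentSpace θ = (sqrtDensityL2Deriv θ : E3 →ₗ[ℝ] L2S2).range := by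
  have h : ∀ v, lineDeriv ℝ sqrtDensityL2 θ v = sqrtDensityL2Deriv θ v := fun v =>
    ((hasStrictFDerivAt_sqrtDensityL2 hθ).hasFDerivAt.hasLineDerivAt v).lineDeriv
  apply le_antisymm
  · rw [tangentSpace, Submodule.span_le]
    rintro _ ⟨i, rfl⟩
    exact ⟨_, (h _).symm⟩
  · rintro _ ⟨v, rfl⟩
    have hm : ∀ i : Fin 3, sqrtDensityL2Deriv θ (stdVec i) ∈ tangentSpace θ := fun i =>
      Submodule.subset_span ⟨i, h _⟩
    change sqrtDensityL2Deriv θ v ∈ _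
    rw [clm_apply_eq_sum]
    exact add_mem (add_mem (Submodule.smul_mem _ _ (hm 0)) (Submodule.smul_mem _ _ (hm 1)))
      (Submodule.smul_mem _ _ (hm 2))

theorem tangentProjection_smoothingOperator (γ : ℝ) (Ω : ℝ → E3) (t : ℝ) (η : E3) {θ : E3}
    (hθ : θ ≠ 0) {u : L2S2} (hu : IsAdjointValue γ Ω t (density η) u)
    (hB : MemLp (smoothingOperator γ Ω t η u (sqrtDensity θ)) 2 surfaceMeasure) :
    tangentProjection θ (hB.toLp _) = sqrtDensityL2Deriv θ (smootherField γ Ω t η θ) := by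
  refine Submodule.eq_starProjection_of_mem_of_inner_eq_zero ?_ ?_
  · rw [tangentSpace_eq_range hθ]
    exact ⟨_, rfl⟩
  · intro w hw
    rw [tangentSpace_eq_range hθ] at hw
    obtain ⟨v, rfl⟩ := hw
    rw [inner_sub_left, sub_eq_zero]
    exact inner_smoothingOperator_eq γ Ω t η hθ hu hB v

/-! ### Recovering the parameter from the square root density -/

/-- √p_θ is proportional to exp(θᵀx/2), so its pairings are exponential moments at θ/2. -/
theorem inner_toLp_sqrtDensityL2 (f : C(S2, ℝ)) (θ : E3) :
    inner ℝ (ContinuousMap.toLp 2 surfaceMeasure ℝ f) (sqrtDensityL2 θ)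
      = Real.exp (-(kappa ‖θ‖ / 2)) * sphereIntegral (f * expForm ((1 / 2 : ℝ) • θ)) := by
  rw [sqrtDensityL2_eq, ContinuousMap.inner_toLp, sphereIntegral_apply, ← integral_const_mul]
  congr 1
  ext x
  simp
  ring

theorem norm_langevin_smul (θ : E3) : ‖(langevin ‖θ‖ / ‖θ‖) • θ‖ = langevin ‖θ‖ := by
  rcases eq_or_ne θ 0 with rfl | hθ
  · simp [langevin_zero]
  · have hr := norm_pos_iff.2 hθ
    have hL := langevin_pos hr
    rw [norm_smul, Real.norm_of_nonneg (by positivity)]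
    field_simp

/-- The vector is the mean of p_θ. Its norm is a strictly increasing function of ‖θ‖, so the norms
converge; rescaling the mean then recovers θ. -/
theorem tendsto_of_tendsto_langevin_smul {ι : Type*} {l : Filter ι} {θ : ι → E3} {θ₀ : E3}
    (hθ₀ : θ₀ ≠ 0)
    (h : Filter.Tendsto (fun i => (langevin ‖θ i‖ / ‖θ i‖) • θ i) l
      (nhds ((langevin ‖θ₀‖ / ‖θ₀‖) • θ₀))) :
    Filter.Tendsto θ l (nhds θ₀) := by
  have hr := norm_pos_iff.2 hθ₀
  have hL := langevin_pos hr
  have hn := h.norm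
  simp only [norm_langevin_smul] at hn
  have hρ : Filter.Tendsto (fun i => ‖θ i‖) l (nhds ‖θ₀‖) := by
    refine tendsto_order.2 ⟨fun a ha => ?_, fun b hb => ?_⟩
    · rcases lt_or_ge a 0 with ha0 | ha0
      · exact Filter.Eventually.of_forall fun i => ha0.trans_le (norm_nonneg _)
      · filter_upwards [hn.eventually_const_lt (langevin_strictMonoOn ha0 hr.le ha)] with i hi
        exact (langevin_strictMonoOn.lt_iff_lt ha0 (norm_nonneg _)).1 hi
    · filter_upwards [hn.eventually_lt_const
        (langevin_strictMonoOn hr.le (hr.le.trans hb.le) hb)] with i hi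
      exact (langevin_strictMonoOn.lt_iff_lt (norm_nonneg _) (hr.le.trans hb.le)).1 hi
  have key : ∀ θ : E3, (‖θ‖ / langevin ‖θ‖) • (langevin ‖θ‖ / ‖θ‖) • θ = θ := by
    intro θ
    rcases eq_or_ne θ 0 with rfl | hθ
    · simp
    · have hr := norm_pos_iff.2 hθ
      have hL := langevin_pos hr
      rw [smul_smul, div_mul_div_cancel₀ hL.ne', div_self hr.ne', one_smul]
  have := (hρ.div hn hL.ne').smul h
  simpa only [key, Pi.div_apply] using this

theorem tendsto_of_tendsto_sqrtDensityL2 {ι : Type*} {l : Filter ι} {θ : ι → E3} {θ₀ : E3}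
    (hθ₀ : θ₀ ≠ 0)
    (h : Filter.Tendsto (fun i => sqrtDensityL2 (θ i)) l (nhds (sqrtDensityL2 θ₀))) :
    Filter.Tendsto θ l (nhds θ₀) := by
  have hF : ∀ f : C(S2, ℝ), Filter.Tendsto
      (fun i => inner ℝ (ContinuousMap.toLp 2 surfaceMeasure ℝ f) (sqrtDensityL2 (θ i))) l
      (nhds (inner ℝ (ContinuousMap.toLp 2 surfaceMeasure ℝ f) (sqrtDensityL2 θ₀))) :=
    fun f => tendsto_const_nhds.inner h
  -- Dividing the first moment by the total mass removes the normalizer and leaves the mean of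
  -- p_{θ/2}.
  have key : ∀ (θ a : E3),
      inner ℝ (ContinuousMap.toLp 2 surfaceMeasure ℝ (linForm a)) (sqrtDensityL2 θ)
        / inner ℝ (ContinuousMap.toLp 2 surfaceMeasure ℝ (1 : C(S2, ℝ))) (sqrtDensityL2 θ)
      = inner ℝ ((langevin ‖(1 / 2 : ℝ) • θ‖ / ‖(1 / 2 : ℝ) • θ‖) • (1 / 2 : ℝ) • θ) a := by
    intro θ a
    rw [inner_toLp_sqrtDensityL2, inner_toLp_sqrtDensityL2, one_mul, sphereIntegral_expForm,
      sphereIntegral_linForm_expForm, inner_smul_left _ _ (langevin _ / _)]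
    simp only [conj_trivial]
    have h1 := (Real.exp_pos (-(kappa ‖θ‖ / 2))).ne'
    have h2 := (Real.exp_pos (kappa ‖(1 / 2 : ℝ) • θ‖)).ne'
    field_simp
  have hpos : inner ℝ (ContinuousMap.toLp 2 surfaceMeasure ℝ (1 : C(S2, ℝ))) (sqrtDensityL2 θ₀)
      ≠ 0 := by
    rw [inner_toLp_sqrtDensityL2, one_mul, sphereIntegral_expForm]
    positivity
  have hq := fun a : E3 => (hF (linForm a)).div (hF 1) hpos
  simp only [Pi.div_def, key] at hq
  have hm : Filter.Tendsto
      (fun i => (langevin ‖(1 / 2 : ℝ) • θ i‖ / ‖(1 / 2 : ℝ) • θ i‖) • (1 / 2 : ℝ) • θ i) l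
      (nhds ((langevin ‖(1 / 2 : ℝ) • θ₀‖ / ‖(1 / 2 : ℝ) • θ₀‖) • (1 / 2 : ℝ) • θ₀)) := by
    have hs := fun k => (hq (stdVec k)).smul_const (stdVec k)
    have := ((hs 0).add (hs 1)).add (hs 2)
    simp only [EuclideanSpace.inner_single_right, conj_trivial, one_mul,
      ← eq_sum_stdVec] at this
    exact this
  have h2 := (tendsto_of_tendsto_langevin_smul (θ := fun i => (1 / 2 : ℝ) • θ i)
    (smul_ne_zero (by norm_num) hθ₀) hm).const_smul (2 : ℝ)
  simpa [smul_smul] using h2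

/-- Applying D* reduces to a map of ℝ³ to itself with invertible derivative D*D. Continuity of the
curve at t, obtained from the L² convergence, keeps it where the local inverse is valid, so the
curve is that inverse applied to a differentiable one. -/
theorem hasDerivWithinAt_of_sqrtDensityL2 {θ : ℝ → E3} {I : Set ℝ} {t : ℝ}
    (hθ : θ t ≠ 0) {c : E3}
    (h : HasDerivWithinAt (fun s => sqrtDensityL2 (θ s)) (sqrtDensityL2Deriv (θ t) c) I t) :
    HasDerivWithinAt θ c I t := by
  set D := sqrtDensityL2Deriv (θ t) with hD
  have hlim : Filter.Tendsto θ (nhdsWithin t I) (nhds (θ t)) :=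
    tendsto_of_tendsto_sqrtDensityL2 hθ h.continuousWithinAt
  have hs : HasStrictFDerivAt (fun θ => ContinuousLinearMap.adjoint D (sqrtDensityL2 θ))
      (gramEquiv hθ : E3 →L[ℝ] E3) (θ t) :=
    (ContinuousLinearMap.adjoint D).hasStrictFDerivAt.comp (θ t)
      (hasStrictFDerivAt_sqrtDensityL2 hθ)
  have h1 := (ContinuousLinearMap.adjoint D).hasFDerivAt.comp_hasDerivWithinAt t h
  have h2 := hs.to_localInverse.hasFDerivAt.comp_hasDerivWithinAt t h1
  have h3 : (gramEquiv hθ).symm (ContinuousLinearMap.adjoint D (D c)) = c :=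
    (gramEquiv hθ).symm_apply_apply c
  refine (h2.congr_of_eventuallyEq ?_ hs.eventually_left_inverse.self_of_nhds.symm).congr_deriv h3
  filter_upwards [hlim.eventually hs.eventually_left_inverse] with s hs'
  exact hs'.symm

end VMF

end

theorem proposition5 (γ : ℝ) (Ω θF θS : ℝ → VMF.E3) (I : Set ℝ) (t : ℝ) (ht : t ∈ I)
    (hθ : θS t ≠ 0) :
    VMF.SolvesProjectionSmoother γ Ω θF θS I t ↔
      HasDerivWithinAt θS
        (-VMF.cross (Ω t) (θS t)
          - (γ ^ 2 * deriv VMF.kappa ‖θS t‖ / (‖θS t‖ * deriv (deriv VMF.kappa) ‖θS t‖)) • θS t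
          + WithLp.toLp 2 ((VMF.gainMatrix γ (θS t)).mulVec (θS t - θF t).ofLp))
        I t := by
  constructor
  · rintro ⟨u, hu, hB, h⟩
    rw [VMF.tangentProjection_smoothingOperator γ Ω t _ hθ hu hB] at h
    exact VMF.hasDerivWithinAt_of_sqrtDensityL2 hθ h
  · intro h
    -- The explicit formal adjoint serves as u; as it is continuous, B is square integrable, and the
    -- chain rule does the rest.
    refine ⟨_, VMF.isAdjointValue_adjointDensity γ Ω t _,
      VMF.memLp_smoothingOperator γ Ω t (θF t) (θS t), ?_⟩
    rw [VMF.tangentProjection_smoothingOperator γ Ω t _ hθ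
      (VMF.isAdjointValue_adjointDensity γ Ω t _)]
    exact (VMF.hasStrictFDerivAt_sqrtDensityL2 hθ).hasFDerivAt.comp_hasDerivWithinAt t h
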